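/- Let $\{c_k\}_{k\ge 1}$ be a sequence of nonnegative real numbers such that, for some constant $V$ (depending only on the sequence), $$\sum_{k=l}^{\infty}|c_k-c_{k+1}|\le V c_l\qquad\text{for all } l\ge 1$$ (in particular, all these series converge). Then the following four assertions hold. (1a) Let $\alpha$ be an even positive integer. If the series $\sum_{k=1}^{\infty}c_k\sin (k^{\alpha}x)$ converges at $x=\frac{\pi}{2}$ or at $x=\frac{2\pi}{3}$, then $\sum_{k=1}^{\infty}c_k<\infty$. (1b) Let $\alpha$ be an odd positive integer and let $f$ be a polynomial of degree $\alpha$ with rational coefficients which contains only odd powers of the variable. If $c_kk\to 0$ as $k\to\infty$, then the series $\sum_{k=1}^{\infty}c_k\sin (f(k)x)$ converges uniformly in $x\in\mathbb{R}$. (2a) Let $\alpha$ be an even positive integer and let $X\subseteq\mathbb{R}$ contain a point of the form $\frac{\pi}{2}+2\pi m$ or $\frac{2\pi}{3}+2\pi m$ with $m\in\mathbb{Z}$. Then the series $\sum_{k=1}^{\infty}c_k\sin (k^{\alpha}x)$ converges uniformly on $X$ if and only if $\sum_{k=1}^{\infty}c_k<\infty$. (2b) Let $\alpha$ be an odd positive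 integer and let $X\subseteq\mathbb{R}$ contain, for some real $\gamma\ge 2$, a discrete $(\alpha,\gamma)$-neighbourhood of zero, that is, all terms of a sequence $\{x_j\}_{j\ge 0}$ such that, for some positive integer $N$, $|x_j|=\dfrac{\pi}{\gamma^{\alpha+1}(N+j)^{\alpha}}$ for all $j\ge 0$. Then the series $\sum_{k=1}^{\infty}c_k\sin (k^{\alpha}x)$ converges uniformly on $X$ if and only if $c_kk\to 0$ as $k\to\infty$. -/

import Mathlib

open Filter Topology

noncomputable section

/-- Rest bounded variation condition for a real sequence `c 1, c 2, …` (the value `c 0` plays no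
role): for some constant `V` depending only on the sequence, the series `∑_{k ≥ l} |c k - c (k+1)|`
converges and is at most `V * c l`, for every `l ≥ 1`. -/
def IsRBVS (c : ℕ → ℝ) : Prop :=
  ∃ V : ℝ, ∀ l : ℕ, 1 ≤ l →
    Summable (fun j : ℕ => |c (l + j) - c (l + j + 1)|) ∧
      ∑' j : ℕ, |c (l + j) - c (l + j + 1)| ≤ V * c l

/-- The partial sum `∑_{k=1}^{N} c_k sin (φ(k) x)`. -/
def sinePartialSum (c φ : ℕ → ℝ) (N : ℕ) (x : ℝ) : ℝ :=
  ∑ k ∈ Finset.Icc 1 N, c k * Real.sin (φ k * x)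

/-- The series `∑_{k=1}^{∞} c_k sin (φ(k) x)` converges at the point `x`. -/
def SineSeriesConvergesAt (c φ : ℕ → ℝ) (x : ℝ) : Prop :=
  ∃ s : ℝ, Tendsto (fun N : ℕ => sinePartialSum c φ N x) atTop (𝓝 s)

/-- The series `∑_{k=1}^{∞} c_k sin (φ(k) x)` converges uniformly for `x` in the set `X`. -/
def SineSeriesConvergesUniformlyOn (c φ : ℕ → ℝ) (X : Set ℝ) : Prop :=
  ∃ g : ℝ → ℝ, TendstoUniformlyOn (sinePartialSum c φ) g atTop X

/-- A discrete `(α, γ)`-neighbourhood of zero: a sequence `x 0, x 1, …` such that, for some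
positive integer `N`, `|x j| = π / (γ ^ (α + 1) * (N + j) ^ α)` for all `j ≥ 0`. -/
def IsDiscreteNhdZero (α γ : ℝ) (x : ℕ → ℝ) : Prop :=
  ∃ N : ℕ, 1 ≤ N ∧
    ∀ j : ℕ, |x j| = Real.pi / (γ ^ (α + 1) * ((N : ℝ) + (j : ℝ)) ^ α)

end

/-! The deep part is uniform convergence for odd polynomials. After clearing denominators the phase
is `2πθF(j)` with `F` an odd integer polynomial; let `T_k` be the partial sums of the sines. Abel
summation over dyadic blocks and the variation condition bound a tail by `sup c_k k` times a
constant depending on `Σ_i 2^{-i} max_{k ≤ 2^i} |T_k|`, so it suffices to bound that sum uniformly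
in `θ` (`exists_bound_sum_sineSum`).

Two facts control it. If `|T_k| ≥ N/K` with `k ≤ N`, Weyl differencing puts `θ` within `K^C/N^deg`
of a rational of denominator at most `K^C` (`weyl_inverse`, `rat_near_of_sineSum_large`). At a
rational of denominator `q`, oddness makes the sum over a full period vanish, so `|T_k| ≤ q`, and
nearby `θ` inherit this up to a term proportional to the distance (`abs_sineSum_le_near_rat`). Hence
the normalized sums attached to one rational decay on both sides of a critical scale and carry a
factor `q^{-η}`. Distinct rationals repel, so those met at later scales have geometrically growing
denominators, and the total stays bounded (`exists_bound_sum_scales`).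

The necessary conditions are elementary. At the special points for even exponents all sines are
nonnegative and one per period is a fixed positive number. Near zero, for odd exponents, a suitable
`x_j` keeps every sine on a block `[M, 2M)` bounded below. In both cases the variation condition
allows `c_m ≤ (V+1) c_l` for `l ≤ m`. -/

/-! ### Weyl differencing. -/

/-- `IsPhase d α g`: the sequence `g` is a polynomial of degree at most `d` whose `d`-th iterated
forward difference with unit steps is the constant `α`. -/
def IsPhase : ℕ → ℝ → (ℕ → ℝ) → Prop
  | 0, α, g => ∀ n, g n = α
  | d + 1, α, g => ∀ h : ℕ, IsPhase d (α * h) (fun n => g (n + h) - g n)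

/-- Expand the square and group pairs of indices by their difference `h`. Doubling the real part
counts the diagonal `h = 0` twice, which accounts for the extra `L`. -/
theorem norm_sq_sum_add_length (z : ℕ → ℂ) (hz : ∀ n, ‖z n‖ = 1) (L : ℕ) :
    ‖∑ n ∈ Finset.range L, z n‖ ^ 2 + L =
      2 * (∑ h ∈ Finset.range L, ∑ n ∈ Finset.range (L - h),
        z (n + h) * (starRingEnd ℂ) (z n)).re := by
  induction L with
  | zero => simp
  | succ L ih =>
    -- The new pairs are exactly those whose larger index is `L`; together they form `z L` times the
    -- conjugate of the whole sum.
    have h1 : ∑ h ∈ Finset.range (L + 1), ∑ n ∈ Finset.range (L + 1 - h),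
        z (n + h) * (starRingEnd ℂ) (z n) =
        (∑ h ∈ Finset.range L, ∑ n ∈ Finset.range (L - h), z (n + h) * (starRingEnd ℂ) (z n)) +
          z L * (starRingEnd ℂ) (∑ n ∈ Finset.range (L + 1), z n) := by
      have h2 : ∀ h ∈ Finset.range (L + 1), ∑ n ∈ Finset.range (L + 1 - h),
          z (n + h) * (starRingEnd ℂ) (z n) =
          (∑ n ∈ Finset.range (L - h), z (n + h) * (starRingEnd ℂ) (z n)) +
            z L * (starRingEnd ℂ) (z (L - h)) := by
        intro h hh
        have hh' : h ≤ L := by simpa [Nat.lt_succ_iff] using hh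
        rw [Nat.sub_add_comm hh', Finset.sum_range_succ, Nat.sub_add_cancel hh']
      rw [Finset.sum_congr rfl h2, Finset.sum_add_distrib, Finset.sum_range_succ, ← Finset.mul_sum,
        map_sum, ← Finset.sum_range_reflect (fun n => (starRingEnd ℂ) (z n)) (L + 1)]
      simp
    have h3 : z L * (starRingEnd ℂ) (z L) = 1 := by
      rw [Complex.mul_conj, Complex.normSq_eq_norm_sq, hz]; simp
    rw [h1, Complex.add_re, mul_add, ← ih, Finset.sum_range_succ, map_add, mul_add, h3,
      ← Complex.normSq_eq_norm_sq, ← Complex.normSq_eq_norm_sq, Complex.normSq_add, Complex.add_re,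
      Complex.normSq_eq_norm_sq (z L), hz]
    have h4 : (z L * (starRingEnd ℂ) (∑ n ∈ Finset.range L, z n)).re =
        ((∑ n ∈ Finset.range L, z n) * (starRingEnd ℂ) (z L)).re := by
      simp only [Complex.mul_re, Complex.conj_re, Complex.conj_im]; ring
    rw [h4]
    push_cast
    simp only [Complex.one_re]
    ring

theorem norm_sq_sum_le (z : ℕ → ℂ) (hz : ∀ n, ‖z n‖ = 1) (L : ℕ) :
    ‖∑ n ∈ Finset.range L, z n‖ ^ 2 ≤
      2 * ∑ h ∈ Finset.range L, ‖∑ n ∈ Finset.range (L - h),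
        z (n + h) * (starRingEnd ℂ) (z n)‖ := by
  have h1 := norm_sq_sum_add_length z hz L
  have h2 := (Complex.re_le_norm (∑ h ∈ Finset.range L, ∑ n ∈ Finset.range (L - h),
        z (n + h) * (starRingEnd ℂ) (z n))).trans (norm_sum_le _ _)
  have h3 : (0 : ℝ) ≤ L := by positivity
  linarith

/-! ### Numbers with many nearly integral multiples. -/

/-- A set of integers congruent modulo `q` on which `θ` is close to integers, in a window so
short that the multiples of `q θ` cannot wrap around. -/
theorem abs_mul_card_le {θ ε η : ℝ} {q : ℕ} {a : ℤ} (hq : 1 ≤ q) (hη : q * θ = a + η)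
    (hε : 2 * ε < 1 / 2) (T : Finset ℕ) {B : ℝ}
    (hmod : ∀ x ∈ T, ∀ y ∈ T, x % q = y % q) (hwin : ∀ x ∈ T, ∀ y ∈ T, (x : ℝ) - y ≤ B)
    (hB : |η| * B ≤ q / 2) (hT : T.Nonempty)
    (hθ : ∀ h ∈ T, ∃ b : ℤ, |θ * h - b| ≤ ε) :
    |η| * (T.card - 1) ≤ 2 * ε := by
  obtain ⟨b₁, hb₁⟩ := hθ _ (T.max'_mem hT)
  obtain ⟨b₀, hb₀⟩ := hθ _ (T.min'_mem hT)
  have hle : T.min' hT ≤ T.max' hT := T.min'_le_max' hT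
  obtain ⟨m, hm⟩ : q ∣ T.max' hT - T.min' hT :=
    (Nat.modEq_iff_dvd' hle).1 (hmod _ (T.min'_mem hT) _ (T.max'_mem hT))
  have hmax : T.max' hT = T.min' hT + q * m := by omega
  have hcard : T.card ≤ m + 1 := by
    have : T.card ≤ (Finset.range (m + 1)).card := by
      apply Finset.card_le_card_of_injOn (fun x => (x - T.min' hT) / q)
      · intro x hx
        simp only [Finset.coe_range, Set.mem_Iio]
        have h1 := T.le_max' x hx
        have h2 : x - T.min' hT ≤ q * m := by omega
        have := Nat.div_le_of_le_mul h2
        omega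
      · intro x hx y hy hxy
        obtain ⟨u, hu⟩ : q ∣ x - T.min' hT :=
          (Nat.modEq_iff_dvd' (T.min'_le x hx)).1 (hmod _ (T.min'_mem hT) _ hx)
        obtain ⟨v, hv⟩ : q ∣ y - T.min' hT :=
          (Nat.modEq_iff_dvd' (T.min'_le y hy)).1 (hmod _ (T.min'_mem hT) _ hy)
        have h1 := T.min'_le x hx
        have h2 := T.min'_le y hy
        simp only [hu, hv, Nat.mul_div_cancel_left _ hq] at hxy
        rw [hxy] at hu
        omega
    simpa using this
  have hcard' : (T.card : ℝ) - 1 ≤ m := by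
    have : (T.card : ℝ) ≤ m + 1 := by exact_mod_cast hcard
    linarith
  have hq' : (0 : ℝ) < q := by exact_mod_cast hq
  have hmB : (q : ℝ) * m ≤ B := by
    have := hwin _ (T.max'_mem hT) _ (T.min'_mem hT)
    rw [hmax] at this
    push_cast at this
    linarith
  have hηm : |η| * m ≤ 1 / 2 := by
    have : |η| * (q * m) ≤ q / 2 := (mul_le_mul_of_nonneg_left hmB (abs_nonneg _)).trans hB
    have h2 : q * (|η| * m) ≤ q * (1 / 2) := by linarith
    exact le_of_mul_le_mul_left h2 hq'
  -- Comparing the two extreme elements puts `η m` within `2ε < 1/2` of an integer. Since `|η| m ≤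
  -- 1/2`, that integer is zero, and so `|η| m ≤ 2ε`.
  have hkey : |η * m - ((b₁ - b₀ - a * m : ℤ) : ℝ)| ≤ 2 * ε := by
    have : η * m - ((b₁ - b₀ - a * m : ℤ) : ℝ) =
        (θ * (T.max' hT : ℕ) - b₁) - (θ * (T.min' hT : ℕ) - b₀) := by
      rw [hmax]
      push_cast
      linear_combination (-(m : ℝ)) * hη
    rw [this]
    exact (abs_sub _ _).trans (by linarith)
  have hηm' : |η * m| = |η| * m := by rw [abs_mul, Nat.abs_cast]
  have hzero : b₁ - b₀ - a * m = 0 := by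
    have h1 : |((b₁ - b₀ - a * m : ℤ) : ℝ)| < 1 := by
      have := abs_sub_abs_le_abs_sub ((b₁ - b₀ - a * m : ℤ) : ℝ) (η * m)
      rw [abs_sub_comm] at this
      linarith
    rw [← Int.cast_abs] at h1
    exact Int.abs_lt_one_iff.1 (by exact_mod_cast h1)
  rw [hzero] at hkey
  simp only [Int.cast_zero, sub_zero] at hkey
  rw [hηm'] at hkey
  exact (mul_le_mul_of_nonneg_left hcard' (abs_nonneg _)).trans hkey

/-- Pigeonhole principle with real bounds. -/
theorem exists_card_le_mul_card_fiber {ι κ : Type*} [DecidableEq κ] (s : Finset ι) (t : Finset κ)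
    (f : ι → κ) (hf : ∀ x ∈ s, f x ∈ t) (ht : t.Nonempty) :
    ∃ y ∈ t, s.card ≤ t.card * (s.filter (fun x => f x = y)).card := by
  by_contra! hcon
  have h1 := Finset.card_eq_sum_card_fiberwise (f := f) (s := s) (t := t) hf
  have h2 : ∑ y ∈ t, t.card * (s.filter (fun x => f x = y)).card < ∑ _y ∈ t, s.card :=
    Finset.sum_lt_sum_of_nonempty ht hcon
  rw [← Finset.mul_sum, ← h1] at h2
  simp at h2

/-- If `θ h` is very close to an integer for a positive proportion of the `h < N`, then `θ` is
extremely close to a rational with a small denominator. -/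
theorem exists_near_rat_of_dense {θ ε K : ℝ} {N : ℕ} (H : Finset ℕ) (hK : 1 ≤ K)
    (hHN : ∀ h ∈ H, h < N) (hcard : (N : ℝ) ≤ K * H.card) (hN : 4 * K ^ 2 ≤ N)
    (hε : ε < 1 / (32 * K)) (hθ : ∀ h ∈ H, ∃ b : ℤ, |θ * h - b| ≤ ε) :
    ∃ q : ℕ, 1 ≤ q ∧ q ≤ 2 * K ∧ ∃ a : ℤ, |q * θ - a| ≤ 4 * K * q * ε / N := by
  have hK0 : 0 < K := by linarith
  have hNpos : (0 : ℝ) < N := by nlinarith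
  have hεK : ε * (32 * K) < 1 := by rwa [lt_div_iff₀ (by positivity)] at hε
  have hHne : H.Nonempty := by
    rw [Finset.nonempty_iff_ne_empty]; rintro rfl
    rw [Finset.card_empty, Nat.cast_zero, mul_zero] at hcard
    linarith
  have hε0 : 0 ≤ ε := by
    obtain ⟨h, hh⟩ := hHne
    obtain ⟨b, hb⟩ := hθ h hh
    exact (abs_nonneg _).trans hb
  have hε2 : 2 * ε < 1 / 2 := by nlinarith
  -- A set of density `1/K` has two elements at distance at most `2K`; their difference serves as
  -- the denominator `q`.
  obtain ⟨x, hx, y, hy, hxy, hclose⟩ : ∃ x ∈ H, ∃ y ∈ H, x < y ∧ (y : ℝ) - x ≤ 2 * K := by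
    by_contra! hcon
    have hinj : H.card ≤ (Finset.range (⌊(N : ℝ) / (2 * K)⌋₊ + 1)).card := by
      apply Finset.card_le_card_of_injOn (fun x : ℕ => ⌊(x : ℝ) / (2 * K)⌋₊)
      · intro x hx
        simp only [Finset.coe_range, Set.mem_Iio]
        refine Nat.lt_succ_of_le (Nat.floor_le_floor ?_)
        have : (x : ℝ) ≤ N := by exact_mod_cast (hHN x hx).le
        gcongr
      · have aux : ∀ x ∈ H, ∀ y ∈ H, x < y → ⌊(x : ℝ) / (2 * K)⌋₊ ≠ ⌊(y : ℝ) / (2 * K)⌋₊ := by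
          intro x hx y hy hxy
          have h1 := hcon x hx y hy hxy
          have h2 : (x : ℝ) / (2 * K) + 1 < y / (2 * K) := by
            rw [div_add_one (by positivity)]
            gcongr
            linarith
          have h3 := Nat.floor_le_floor h2.le
          rw [Nat.floor_add_one (by positivity)] at h3
          omega
        intro x hx y hy hxy
        by_contra hne
        rcases lt_or_gt_of_ne hne with h | h
        · exact aux x hx y hy h hxy
        · exact aux y hy x hx h hxy.symm
    rw [Finset.card_range] at hinj
    have h1 : (H.card : ℝ) ≤ N / (2 * K) + 1 := by
      have : (H.card : ℝ) ≤ ⌊(N : ℝ) / (2 * K)⌋₊ + 1 := by exact_mod_cast hinj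
      have := Nat.floor_le (a := (N : ℝ) / (2 * K)) (by positivity)
      linarith
    have h2 : K * (N / (2 * K) + 1) = N / 2 + K := by field_simp
    have h3 := mul_le_mul_of_nonneg_left h1 hK0.le
    nlinarith
  obtain ⟨b, hb⟩ := hθ y hy
  obtain ⟨b', hb'⟩ := hθ x hx
  obtain ⟨q, rfl⟩ : ∃ q, y = x + q := ⟨y - x, by omega⟩
  have hq1 : 1 ≤ q := by omega
  have hq0 : (0 : ℝ) < q := by exact_mod_cast hq1
  have hq2 : (q : ℝ) ≤ 2 * K := by push_cast at hclose; linarith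
  refine ⟨q, hq1, hq2, b - b', ?_⟩
  set η : ℝ := q * θ - ((b - b' : ℤ) : ℝ) with hηdef
  have hη : q * θ = ((b - b' : ℤ) : ℝ) + η := by rw [hηdef]; ring
  have hη2 : |η| ≤ 2 * ε := by
    have : η = (θ * (x + q : ℕ) - b) - (θ * x - b') := by rw [hηdef]; push_cast; ring
    rw [this]
    exact (abs_sub _ _).trans (by linarith)
  -- If the drift over the whole range cannot wrap around, one residue class modulo `q` holds enough
  -- elements to give the bound. The other case is contradictory.
  by_cases hcase : |η| * N ≤ q / 2
  · obtain ⟨r, hr, hrc⟩ := exists_card_le_mul_card_fiber H (Finset.range q) (fun h => h % q)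
      (fun h _ => Finset.mem_range.2 (Nat.mod_lt _ hq1)) ⟨0, Finset.mem_range.2 hq1⟩
    rw [Finset.card_range] at hrc
    set T := H.filter (fun h => h % q = r) with hT
    have hTne : T.Nonempty := by
      rw [Finset.nonempty_iff_ne_empty]
      intro h
      rw [h, Finset.card_empty, mul_zero] at hrc
      exact hHne.card_pos.not_ge hrc
    have hmain := abs_mul_card_le hq1 hη hε2 T (B := N)
      (fun x hx y hy => by
        rw [(Finset.mem_filter.1 hx).2, (Finset.mem_filter.1 hy).2])
      (fun x hx y hy => by
        have h1 : (x : ℝ) ≤ N := by exact_mod_cast (hHN x (Finset.mem_filter.1 hx).1).le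
        have h2 : (0 : ℝ) ≤ y := by positivity
        linarith) hcase hTne (fun h hh => hθ h (Finset.mem_filter.1 hh).1)
    have hrc' : (H.card : ℝ) ≤ q * T.card := by exact_mod_cast hrc
    have h5 : (N : ℝ) ≤ K * (q * T.card) :=
      hcard.trans (mul_le_mul_of_nonneg_left hrc' hK0.le)
    have h6 : 2 * K * q ≤ N := by nlinarith
    have h7 : (N : ℝ) ≤ 2 * K * q * (T.card - 1) := by nlinarith
    rw [le_div_iff₀ hNpos]
    calc |η| * N ≤ |η| * (2 * K * q * (T.card - 1)) :=
          mul_le_mul_of_nonneg_left h7 (abs_nonneg _)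
      _ = 2 * K * q * (|η| * (T.card - 1)) := by ring
      _ ≤ 2 * K * q * (2 * ε) := mul_le_mul_of_nonneg_left hmain (by positivity)
      _ = 4 * K * q * ε := by ring
  · exfalso
    push Not at hcase
    have hηpos : 0 < |η| := by
      by_contra h
      have : |η| = 0 := le_antisymm (not_lt.1 h) (abs_nonneg _)
      rw [this] at hcase
      linarith
    -- `R` is the longest window without wrap-around. A pigeonhole over residues and windows yields
    -- `|η| * T.card ≤ 4ε`, too small for the density of `H` once `32Kε < 1`.
    set R : ℝ := q / (2 * |η|) with hR
    have hRη : |η| * R = q / 2 := by rw [hR]; field_simp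
    have hR1 : 1 ≤ R := by
      rw [hR, le_div_iff₀ (by positivity)]
      have : (1 : ℝ) ≤ q := by exact_mod_cast hq1
      linarith
    have hRN : R < N := by
      by_contra h
      push Not at h
      have := mul_le_mul_of_nonneg_left h hηpos.le
      linarith
    obtain ⟨⟨r, s⟩, hr, hrc⟩ := exists_card_le_mul_card_fiber H
      (Finset.range q ×ˢ Finset.range (⌊N / R⌋₊ + 1)) (fun h => (h % q, ⌊(h : ℝ) / R⌋₊))
      (fun h hh => by
        refine Finset.mem_product.2 ⟨Finset.mem_range.2 (Nat.mod_lt _ hq1), Finset.mem_range.2 ?_⟩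
        refine Nat.lt_succ_of_le (Nat.floor_le_floor ?_)
        have : (h : ℝ) ≤ N := by exact_mod_cast (hHN h hh).le
        gcongr) ⟨(0, 0), by simp; omega⟩
    rw [Finset.card_product, Finset.card_range, Finset.card_range] at hrc
    set T := H.filter (fun h => (h % q, ⌊(h : ℝ) / R⌋₊) = (r, s)) with hT
    have hTne : T.Nonempty := by
      rw [Finset.nonempty_iff_ne_empty]
      intro h
      rw [h, Finset.card_empty, mul_zero] at hrc
      exact hHne.card_pos.not_ge hrc
    have hT' : ∀ x ∈ T, x ∈ H ∧ x % q = r ∧ ⌊(x : ℝ) / R⌋₊ = s := by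
      intro x hx
      exact ⟨(Finset.mem_filter.1 hx).1, Prod.ext_iff.1 (Finset.mem_filter.1 hx).2⟩
    have hmain := abs_mul_card_le hq1 hη hε2 T (B := R)
      (fun x hx y hy => by rw [(hT' x hx).2.1, (hT' y hy).2.1])
      (fun x hx y hy => by
        have h1 := Nat.lt_floor_add_one ((x : ℝ) / R)
        have h2 := Nat.floor_le (a := (y : ℝ) / R) (by positivity)
        rw [(hT' x hx).2.2] at h1
        rw [(hT' y hy).2.2] at h2
        rw [div_lt_iff₀ (by linarith)] at h1
        rw [le_div_iff₀ (by linarith)] at h2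
        linarith) hRη.le hTne (fun h hh => hθ h (hT' h hh).1)
    have hrc' : (H.card : ℝ) ≤ q * (⌊N / R⌋₊ + 1) * T.card := by exact_mod_cast hrc
    have hfl : ((⌊N / R⌋₊ : ℝ) + 1) ≤ 2 * (N / R) := by
      have h1 := Nat.floor_le (a := (N : ℝ) / R) (by positivity)
      have h2 : 1 ≤ N / R := by rw [le_div_iff₀ (by linarith)]; linarith
      linarith
    have h5 : (N : ℝ) ≤ K * (q * (2 * (N / R)) * T.card) := by
      refine hcard.trans (mul_le_mul_of_nonneg_left (hrc'.trans ?_) hK0.le)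
      exact mul_le_mul_of_nonneg_right (mul_le_mul_of_nonneg_left hfl hq0.le) (Nat.cast_nonneg _)
    have h6 : R ≤ 2 * K * q * T.card := by
      have h7 : K * (q * (2 * (N / R)) * T.card) = (2 * K * q * T.card) * N / R := by ring
      rw [h7, le_div_iff₀ (by linarith)] at h5
      have : N * R ≤ N * (2 * K * q * T.card) := by linarith
      exact le_of_mul_le_mul_left this hNpos
    have h8 : (q : ℝ) / 2 ≤ q * (2 * K * (|η| * T.card)) := by
      calc (q : ℝ) / 2 = |η| * R := hRη.symm
        _ ≤ |η| * (2 * K * q * T.card) := mul_le_mul_of_nonneg_left h6 hηpos.le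
        _ = q * (2 * K * (|η| * T.card)) := by ring
    have h9 : 1 / 2 ≤ 2 * K * (|η| * T.card) := by
      have : q * (1 / 2) ≤ q * (2 * K * (|η| * T.card)) := by linarith
      exact le_of_mul_le_mul_left this hq0
    have h10 : |η| * T.card ≤ 4 * ε := by linarith
    nlinarith

/-! ### Exponential sums and the inverse theorem. -/

/-- The additive character `x ↦ exp (2 π i x)` of the line. -/
noncomputable def expPhase (x : ℝ) : ℂ := Complex.exp ((2 * Real.pi * x : ℝ) * Complex.I)

theorem norm_expPhase (x : ℝ) : ‖expPhase x‖ = 1 := Complex.norm_exp_ofReal_mul_I _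

theorem expPhase_im (x : ℝ) : (expPhase x).im = Real.sin (2 * Real.pi * x) :=
  Complex.exp_ofReal_mul_I_im _

theorem expPhase_add (x y : ℝ) : expPhase (x + y) = expPhase x * expPhase y := by
  rw [expPhase, expPhase, expPhase, ← Complex.exp_add]
  congr 1
  push_cast
  ring

theorem expPhase_sub (x y : ℝ) :
    expPhase (x - y) = expPhase x * (starRingEnd ℂ) (expPhase y) := by
  rw [expPhase, expPhase, expPhase, ← Complex.exp_conj, ← Complex.exp_add]
  congr 1
  simp only [map_mul, Complex.conj_I, Complex.conj_ofReal]
  push_cast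
  ring

theorem expPhase_nat_mul (α : ℝ) (n : ℕ) : expPhase (α * n) = expPhase α ^ n := by
  rw [expPhase, expPhase, ← Complex.exp_nat_mul]
  congr 1
  push_cast
  ring

theorem expPhase_int (n : ℤ) : expPhase n = 1 := by
  rw [expPhase, Complex.exp_eq_one_iff]
  exact ⟨n, by push_cast; ring⟩

theorem four_mul_abs_sub_round_le (α : ℝ) : 4 * |α - round α| ≤ ‖expPhase α - 1‖ := by
  set t := α - round α with ht
  have h1 : expPhase α = expPhase t := by
    rw [ht, expPhase_sub, expPhase_int, map_one, mul_one]
  have h2 : |t| ≤ 1 / 2 := abs_sub_round α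
  have h3 : ‖expPhase t - 1‖ = 2 * |Real.sin (Real.pi * t)| := by
    rw [expPhase, mul_comm _ Complex.I, Complex.norm_exp_I_mul_ofReal_sub_one, norm_mul]
    norm_num
    congr 2
    ring
  rw [h1, h3]
  have h4 : 2 / Real.pi * |Real.pi * t| ≤ |Real.sin (Real.pi * t)| := by
    apply Real.mul_abs_le_abs_sin
    rw [abs_mul, abs_of_pos Real.pi_pos]
    nlinarith [Real.pi_pos]
  rw [abs_mul, abs_of_pos Real.pi_pos] at h4
  have h5 : 2 / Real.pi * (Real.pi * |t|) = 2 * |t| := by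
    field_simp
  linarith

/-- Geometric series. The product form stays valid when `α` is an integer. -/
theorem norm_sum_linear_phase_le (α β : ℝ) (L : ℕ) :
    |α - round α| * ‖∑ n ∈ Finset.range L, expPhase (β + α * n)‖ ≤ 1 / 2 := by
  have h1 : ∑ n ∈ Finset.range L, expPhase (β + α * n) =
      expPhase β * ∑ n ∈ Finset.range L, expPhase α ^ n := by
    rw [Finset.mul_sum]
    exact Finset.sum_congr rfl fun n _ => by rw [expPhase_add, expPhase_nat_mul]
  have h2 : ‖∑ n ∈ Finset.range L, expPhase α ^ n‖ * ‖expPhase α - 1‖ ≤ 2 := by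
    rw [← norm_mul, geom_sum_mul]
    refine (norm_sub_le _ _).trans ?_
    rw [norm_pow, norm_expPhase]
    norm_num
  rw [h1, norm_mul, norm_expPhase, one_mul]
  have h3 := four_mul_abs_sub_round_le α
  nlinarith [norm_nonneg (∑ n ∈ Finset.range L, expPhase α ^ n)]

/-- The differencing step: a large exponential sum has many large differenced sums. -/
theorem card_large_differences {g : ℕ → ℝ} {K : ℝ} {N L : ℕ} (hK : 0 < K) (hN : 1 ≤ N)
    (hL : L ≤ N) (hg : N ≤ K * ‖∑ n ∈ Finset.range L, expPhase (g n)‖) :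
    (N : ℝ) ≤ 4 * K ^ 2 * ((Finset.range L).filter (fun h => (N : ℝ) ≤ 4 * K ^ 2 *
      ‖∑ n ∈ Finset.range (L - h), expPhase (g (n + h) - g n)‖)).card := by
  set A : ℕ → ℝ := fun h => ‖∑ n ∈ Finset.range (L - h), expPhase (g (n + h) - g n)‖ with hA
  have hNpos : (0 : ℝ) < N := by exact_mod_cast hN
  have hA1 : ∀ h, A h ≤ N := by
    intro h
    refine (norm_sum_le _ _).trans ?_
    simp only [norm_expPhase, Finset.sum_const, Finset.card_range, nsmul_eq_mul, mul_one]
    exact_mod_cast (Nat.sub_le _ _).trans hL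
  have h1 := norm_sq_sum_le (fun n => expPhase (g n)) (fun n => norm_expPhase _) L
  simp only [← expPhase_sub] at h1
  set S := (Finset.range L).filter (fun h => (N : ℝ) ≤ 4 * K ^ 2 * A h) with hS
  -- With the threshold `N / (4K²)`, the shifts outside `S` account for at most half of the lower
  -- bound `N²`, so `S` must supply the rest.
  have h2 : ∑ h ∈ Finset.range L, A h ≤ S.card * N + N * (N / (4 * K ^ 2)) := by
    rw [← Finset.sum_filter_add_sum_filter_not (Finset.range L)
      (fun h => (N : ℝ) ≤ 4 * K ^ 2 * A h)]
    refine add_le_add ?_ ?_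
    · refine (Finset.sum_le_card_nsmul _ _ _ fun h _ => hA1 h).trans ?_
      rw [nsmul_eq_mul]
    · refine (Finset.sum_le_card_nsmul _ _ (N / (4 * K ^ 2)) ?_).trans ?_
      · intro h hh
        rw [le_div_iff₀ (by positivity)]
        have := (Finset.mem_filter.1 hh).2
        linarith
      · rw [nsmul_eq_mul]
        refine mul_le_mul_of_nonneg_right ?_ (by positivity)
        have := Finset.card_filter_le (Finset.range L) (fun h => ¬ (N : ℝ) ≤ 4 * K ^ 2 * A h)
        rw [Finset.card_range] at this
        exact_mod_cast this.trans hL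
  have h3 : (N : ℝ) ^ 2 ≤ K ^ 2 * (2 * (S.card * N + N * (N / (4 * K ^ 2)))) := by
    calc (N : ℝ) ^ 2 ≤ (K * ‖∑ n ∈ Finset.range L, expPhase (g n)‖) ^ 2 :=
          pow_le_pow_left₀ hNpos.le hg 2
      _ = K ^ 2 * ‖∑ n ∈ Finset.range L, expPhase (g n)‖ ^ 2 := by ring
      _ ≤ _ := by
          refine mul_le_mul_of_nonneg_left (h1.trans ?_) (by positivity)
          linarith
  have h4 : K ^ 2 * (2 * (S.card * N + N * (N / (4 * K ^ 2)))) =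
      N * (2 * K ^ 2 * S.card + N / 2) := by
    field_simp
    ring
  rw [h4, sq] at h3
  have := le_of_mul_le_mul_left h3 hNpos
  linarith

/-- Inverse theorem for Weyl sums: a large sum forces the top coefficient of the phase to be
close to a rational with small denominator, with polynomial dependence on the size. -/
theorem weyl_inverse (d : ℕ) : ∃ C : ℕ, ∀ (K : ℝ) (N L : ℕ) (α : ℝ) (g : ℕ → ℝ), 2 ≤ K → 1 ≤ N →
    L ≤ N → IsPhase (d + 1) α g → N ≤ K * ‖∑ n ∈ Finset.range L, expPhase (g n)‖ →
    ∃ q : ℕ, 1 ≤ q ∧ q ≤ K ^ C ∧ ∃ a : ℤ, |q * α - a| ≤ K ^ C / (N : ℝ) ^ (d + 1) := by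
  induction d with
  | zero =>
    refine ⟨1, fun K N L α g hK hN hL hg hS => ⟨1, le_rfl, by simp; linarith, round α, ?_⟩⟩
    have hNpos : (0 : ℝ) < N := by exact_mod_cast hN
    have h1 : ∀ n, g n = g 0 + α * n := by
      intro n
      have := hg n 0
      simp only [zero_add] at this
      linarith
    have h2 := norm_sum_linear_phase_le α (g 0) L
    rw [Finset.sum_congr rfl fun n _ => by rw [h1 n]] at hS
    rw [le_div_iff₀ (by positivity)]
    simp only [Nat.cast_one, one_mul, pow_one, zero_add]
    calc |α - round α| * N ≤ |α - round α| *
          (K * ‖∑ n ∈ Finset.range L, expPhase (g 0 + α * n)‖) :=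
          mul_le_mul_of_nonneg_left hS (abs_nonneg _)
      _ = K * (|α - round α| * ‖∑ n ∈ Finset.range L, expPhase (g 0 + α * n)‖) := by ring
      _ ≤ K * (1 / 2) := mul_le_mul_of_nonneg_left h2 (by linarith)
      _ ≤ K := by linarith
  | succ d ih =>
    obtain ⟨C, hC⟩ := ih
    -- The first summand makes the claim trivial for `N < K ^ (8C+14)`, with `q = 1` and the nearest
    -- integer. The second collects the losses of the inductive step for larger `N`.
    refine ⟨(8 * C + 14) * (d + 2) + (12 * C + 11), fun K N L α g hK hN hL hg hS => ?_⟩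
    have hK1 : 1 ≤ K := by linarith
    have hK0 : 0 < K := by linarith
    have hNpos : (0 : ℝ) < N := by exact_mod_cast hN
    have hN1 : (1 : ℝ) ≤ N := by exact_mod_cast hN
    by_cases hbig : (N : ℝ) < K ^ (8 * C + 14)
    · refine ⟨1, le_rfl, by simpa using one_le_pow₀ hK1, round α, ?_⟩
      have h1 : (1 : ℝ) ≤ K ^ ((8 * C + 14) * (d + 2) + (12 * C + 11)) / (N : ℝ) ^ (d + 2) := by
        rw [le_div_iff₀ (by positivity), one_mul]
        calc (N : ℝ) ^ (d + 2) ≤ (K ^ (8 * C + 14)) ^ (d + 2) :=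
              pow_le_pow_left₀ hNpos.le hbig.le _
          _ = K ^ ((8 * C + 14) * (d + 2)) := by rw [← pow_mul]
          _ ≤ _ := pow_le_pow_right₀ hK1 (by omega)
      have h2 := abs_sub_round α
      simp only [Nat.cast_one, one_mul]
      exact h2.trans (by linarith)
    push Not at hbig
    have h4K : 4 * K ^ 2 ≤ K ^ 4 := by
      calc 4 * K ^ 2 = 2 ^ 2 * K ^ 2 := by norm_num
        _ ≤ K ^ 2 * K ^ 2 := by gcongr
        _ = K ^ 4 := by ring
    set S := (Finset.range L).filter (fun h => (N : ℝ) ≤ 4 * K ^ 2 *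
      ‖∑ n ∈ Finset.range (L - h), expPhase (g (n + h) - g n)‖) with hSdef
    have hcard : (N : ℝ) ≤ 4 * K ^ 2 * S.card := card_large_differences hK0 hN hL hS
    have hdiff : ∀ h ∈ S, ∃ q : ℕ, 1 ≤ q ∧ q ≤ K ^ (4 * C) ∧
        ∃ a : ℤ, |q * (α * h) - a| ≤ K ^ (4 * C) / (N : ℝ) ^ (d + 1) := by
      intro h hh
      obtain ⟨q, hq1, hq2, a, ha⟩ := hC (4 * K ^ 2) N (L - h) (α * h) _ (by nlinarith) hN
        ((Nat.sub_le _ _).trans hL) (hg h) (Finset.mem_filter.1 hh).2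
      have hp : (4 * K ^ 2) ^ C ≤ K ^ (4 * C) := by
        rw [pow_mul]
        exact pow_le_pow_left₀ (by positivity) h4K C
      exact ⟨q, hq1, hq2.trans hp, a, ha.trans (by gcongr)⟩
    choose! q hq1 hq2 a ha using hdiff
    have hfl : 1 ≤ ⌊K ^ (4 * C)⌋₊ := Nat.le_floor (by simpa using one_le_pow₀ hK1)
    -- The denominators given by induction depend on `h`. Fixing the most popular one, `q₀`, costs a
    -- factor `K ^ (4C)` in density and makes `q₀ α h` nearly integral for all remaining `h`.
    obtain ⟨q₀, hq₀, hfib⟩ := exists_card_le_mul_card_fiber S (Finset.Icc 1 ⌊K ^ (4 * C)⌋₊) q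
      (fun h hh => Finset.mem_Icc.2 ⟨hq1 h hh, Nat.le_floor (hq2 h hh)⟩)
      ⟨1, Finset.mem_Icc.2 ⟨le_rfl, hfl⟩⟩
    rw [Nat.card_Icc, Nat.add_sub_cancel] at hfib
    set T := S.filter (fun h => q h = q₀) with hT
    have hq₀1 : 1 ≤ q₀ := (Finset.mem_Icc.1 hq₀).1
    have hq₀2 : (q₀ : ℝ) ≤ K ^ (4 * C) :=
      (Nat.le_floor_iff (by positivity)).1 (Finset.mem_Icc.1 hq₀).2
    have hTcard : (N : ℝ) ≤ K ^ (4 * C + 4) * T.card := by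
      have h1 : (S.card : ℝ) ≤ K ^ (4 * C) * T.card := by
        have : (S.card : ℝ) ≤ ⌊K ^ (4 * C)⌋₊ * T.card := by exact_mod_cast hfib
        refine this.trans (mul_le_mul_of_nonneg_right ?_ (by positivity))
        exact Nat.floor_le (by positivity)
      calc (N : ℝ) ≤ 4 * K ^ 2 * S.card := hcard
        _ ≤ K ^ 4 * (K ^ (4 * C) * T.card) := by gcongr
        _ = K ^ (4 * C + 4) * T.card := by ring
    have h64 : (64 : ℝ) ≤ K ^ 6 := by
      calc (64 : ℝ) = 2 ^ 6 := by norm_num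
        _ ≤ K ^ 6 := pow_le_pow_left₀ (by norm_num) hK 6
    have hε : K ^ (4 * C) / (N : ℝ) ^ (d + 1) < 1 / (32 * K ^ (4 * C + 4)) := by
      rw [div_lt_div_iff₀ (by positivity) (by positivity), one_mul]
      have h1 : (N : ℝ) ≤ (N : ℝ) ^ (d + 1) := le_self_pow₀ hN1 (by omega)
      calc K ^ (4 * C) * (32 * K ^ (4 * C + 4)) = 32 * K ^ (8 * C + 4) := by ring
        _ < K ^ 6 * K ^ (8 * C + 4) := by
            refine mul_lt_mul_of_pos_right (by linarith) (by positivity)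
        _ = K ^ (8 * C + 10) := by ring
        _ ≤ K ^ (8 * C + 14) := pow_le_pow_right₀ hK1 (by omega)
        _ ≤ N := hbig
        _ ≤ _ := h1
    obtain ⟨q₁, hq₁1, hq₁2, b, hb⟩ := exists_near_rat_of_dense (θ := q₀ * α) T
      (one_le_pow₀ hK1 : 1 ≤ K ^ (4 * C + 4))
      (fun h hh => lt_of_lt_of_le (Finset.mem_range.1
        (Finset.mem_filter.1 (Finset.mem_filter.1 hh).1).1) hL) hTcard
      (by
        calc 4 * (K ^ (4 * C + 4)) ^ 2 ≤ K ^ 6 * (K ^ (4 * C + 4)) ^ 2 := by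
              gcongr; linarith
          _ = K ^ (8 * C + 14) := by ring
          _ ≤ N := hbig) hε
      (fun h hh => by
        obtain ⟨hhS, hhq⟩ := Finset.mem_filter.1 hh
        refine ⟨a h, ?_⟩
        have := ha h hhS
        rw [hhq] at this
        rwa [mul_assoc])
    refine ⟨q₁ * q₀, Nat.mul_pos hq₁1 hq₀1, ?_, b, ?_⟩
    · push_cast
      calc (q₁ : ℝ) * q₀ ≤ (2 * K ^ (4 * C + 4)) * K ^ (4 * C) := by gcongr
        _ ≤ (K * K ^ (4 * C + 4)) * K ^ (4 * C) := by gcongr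
        _ = K ^ (8 * C + 5) := by ring
        _ ≤ _ := pow_le_pow_right₀ hK1 (by nlinarith)
    · push_cast
      rw [mul_assoc]
      refine hb.trans ?_
      calc 4 * K ^ (4 * C + 4) * q₁ * (K ^ (4 * C) / (N : ℝ) ^ (d + 1)) / N
          ≤ 4 * K ^ (4 * C + 4) * (2 * K ^ (4 * C + 4)) * (K ^ (4 * C) / (N : ℝ) ^ (d + 1)) / N := by
            gcongr
        _ = 2 ^ 3 * K ^ (12 * C + 8) / (N : ℝ) ^ (d + 2) := by
            field_simp
            ring
        _ ≤ K ^ 3 * K ^ (12 * C + 8) / (N : ℝ) ^ (d + 2) := by gcongr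
        _ = K ^ (12 * C + 11) / (N : ℝ) ^ (d + 2) := by ring
        _ ≤ _ := by
            exact div_le_div_of_nonneg_right (pow_le_pow_right₀ hK1 (Nat.le_add_left _ _))
              (by positivity)

/-! ### Sine sums of integer polynomials near rationals. -/

theorem isPhase_eval (d : ℕ) (p : Polynomial ℝ) (hp : p.natDegree ≤ d) :
    IsPhase d (d.factorial * p.coeff d) (fun n : ℕ => p.eval (n : ℝ)) := by
  induction d generalizing p with
  | zero =>
    intro n
    rw [Polynomial.eq_C_of_natDegree_le_zero hp]
    simp
  | succ d ih =>
    intro h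
    set r : Polynomial ℝ := Polynomial.taylor (h : ℝ) p - p with hr
    -- Only the top two coefficients of the shifted polynomial matter: the first cancels in `r`, the
    -- second yields the new top coefficient `(d + 1) * p.coeff (d + 1) * h`.
    have hd1 : (Polynomial.taylor (h : ℝ) p).coeff (d + 1) = p.coeff (d + 1) := by
      rw [Polynomial.taylor_coeff, Polynomial.eval_eq_sum_range' (n := 1)
        (lt_of_le_of_lt (Polynomial.natDegree_hasseDeriv_le _ _) (by omega))]
      simp [Polynomial.hasseDeriv_coeff]
    have hd0 : (Polynomial.taylor (h : ℝ) p).coeff d =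
        p.coeff d + (d + 1) * p.coeff (d + 1) * h := by
      rw [Polynomial.taylor_coeff, Polynomial.eval_eq_sum_range' (n := 2)
        (lt_of_le_of_lt (Polynomial.natDegree_hasseDeriv_le _ _) (by omega))]
      simp [Polynomial.hasseDeriv_coeff, Finset.sum_range_succ, add_comm 1 d]
    have hrdeg : r.natDegree ≤ d := by
      rw [Polynomial.natDegree_le_iff_coeff_eq_zero]
      intro m hm
      rw [hr, Polynomial.coeff_sub]
      rcases Nat.eq_or_lt_of_le (Nat.succ_le_of_lt hm) with h1 | h1
      · rw [← h1, Nat.succ_eq_add_one, hd1, sub_self]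
      · rw [Polynomial.coeff_eq_zero_of_natDegree_lt (p := p) (by omega),
          Polynomial.coeff_eq_zero_of_natDegree_lt
            (by rw [Polynomial.natDegree_taylor]; omega), sub_self]
    have := ih r hrdeg
    convert this using 1
    · rw [hr, Polynomial.coeff_sub, hd0, Nat.factorial_succ]
      push_cast
      ring
    · funext n
      rw [hr, Polynomial.eval_sub, Polynomial.taylor_eval]
      push_cast
      ring_nf

/-- The sums `∑_{j < k} sin (2 π θ F(j))`. -/
noncomputable def sineSum (F : Polynomial ℤ) (θ : ℝ) (k : ℕ) : ℝ :=
  ∑ j ∈ Finset.range k, Real.sin (2 * Real.pi * (θ * (F.eval (j : ℤ) : ℤ)))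

theorem abs_sineSum_le_length (F : Polynomial ℤ) (θ : ℝ) (k : ℕ) : |sineSum F θ k| ≤ k := by
  refine (Finset.abs_sum_le_sum_abs _ _).trans ?_
  refine (Finset.sum_le_card_nsmul _ _ 1 fun j _ => Real.abs_sin_le_one _).trans ?_
  simp

/-- The sine sum is the imaginary part of a Weyl sum whose top difference is `A θ` with a fixed
nonzero integer `A`. Dividing the approximation by `q A` costs only a bounded factor in the
denominator, absorbed by one more power of `K`. -/
theorem rat_near_of_sineSum_large (F : Polynomial ℤ) {d : ℕ} (hF : F.natDegree = d + 1) :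
    ∃ (C : ℕ) (K₀ : ℝ), 1 ≤ C ∧ 2 ≤ K₀ ∧ ∀ (K : ℝ) (N k : ℕ) (θ : ℝ), K₀ ≤ K → 1 ≤ N → k ≤ N →
      N ≤ K * |sineSum F θ k| →
      ∃ r : ℚ, (r.den : ℝ) ≤ K ^ C ∧ (N : ℝ) ^ (d + 1) * |θ - r| ≤ K ^ C := by
  obtain ⟨C, hC⟩ := weyl_inverse d
  set A : ℤ := (d + 1).factorial * F.coeff (d + 1) with hA
  have hA0 : A ≠ 0 := by
    refine mul_ne_zero (by exact_mod_cast (Nat.factorial_pos _).ne') ?_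
    rw [← hF, Polynomial.coeff_natDegree, Ne, Polynomial.leadingCoeff_eq_zero]
    rintro rfl
    simp at hF
  have hA1 : (1 : ℝ) ≤ |(A : ℝ)| := by exact_mod_cast Int.one_le_abs hA0
  refine ⟨C + 1, max 2 |(A : ℝ)|, by omega, le_max_left _ _, fun K N k θ hK hN hk hS => ?_⟩
  have hK2 : 2 ≤ K := (le_max_left _ _).trans hK
  have hKA : |(A : ℝ)| ≤ K := (le_max_right _ _).trans hK
  have hNpos : (0 : ℝ) < N := by exact_mod_cast hN
  have hphase := isPhase_eval (d + 1) (Polynomial.C θ * F.map (Int.castRingHom ℝ))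
    ((Polynomial.natDegree_C_mul_le _ _).trans ((Polynomial.natDegree_map_le).trans hF.le))
  have heval : ∀ j : ℕ, (Polynomial.C θ * F.map (Int.castRingHom ℝ)).eval (j : ℝ) =
      θ * (F.eval (j : ℤ) : ℤ) := by
    intro j
    rw [Polynomial.eval_mul, Polynomial.eval_C]
    congr 1
    have := Polynomial.eval_intCast_map (Int.castRingHom ℝ) F (j : ℤ)
    simp only [eq_intCast, Int.cast_natCast] at this
    exact this
  obtain ⟨q, hq1, hq2, a, ha⟩ := hC K N k _ _ hK2 hN hk hphase (by
    refine hS.trans (mul_le_mul_of_nonneg_left ?_ (by linarith))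
    have : sineSum F θ k = (∑ n ∈ Finset.range k, expPhase
        ((Polynomial.C θ * F.map (Int.castRingHom ℝ)).eval (n : ℝ))).im := by
      rw [Complex.im_sum]
      exact Finset.sum_congr rfl fun j _ => by rw [expPhase_im, heval]
    rw [this]
    exact Complex.abs_im_le_norm _)
  have hcoeff : ((d + 1).factorial : ℝ) * (Polynomial.C θ * F.map (Int.castRingHom ℝ)).coeff (d + 1)
      = A * θ := by
    rw [Polynomial.coeff_C_mul, Polynomial.coeff_map, hA]
    push_cast
    simp
    ring
  rw [hcoeff] at ha
  have hq0 : (1 : ℝ) ≤ q := by exact_mod_cast hq1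
  have hqA0 : (q : ℤ) * A ≠ 0 := mul_ne_zero (by omega) hA0
  refine ⟨((a : ℤ) : ℚ) / ((q * A : ℤ) : ℚ), ?_, ?_⟩
  · have h1 : (((a : ℚ) / ((q * A : ℤ) : ℚ)).den : ℤ) ≤ |(q : ℤ) * A| :=
      by
      refine Int.le_of_dvd (abs_pos.2 hqA0) ((dvd_abs _ _).2 ?_)
      have := Rat.den_dvd a (q * A)
      rwa [Rat.divInt_eq_div] at this
    have h2 : (((a : ℚ) / ((q * A : ℤ) : ℚ)).den : ℝ) ≤ |(q : ℝ) * A| := by exact_mod_cast h1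
    refine h2.trans ?_
    rw [abs_mul, Nat.abs_cast, pow_succ]
    exact mul_le_mul hq2 hKA (abs_nonneg _) (by positivity)
  · have h1 : θ - (((a : ℚ) / ((q * A : ℤ) : ℚ) : ℚ) : ℝ) = (q * (A * θ) - a) / (q * A) := by
      have : (A : ℝ) ≠ 0 := by exact_mod_cast hA0
      push_cast
      field_simp
    have h2 : (1 : ℝ) ≤ |(q : ℝ) * A| := by
      rw [abs_mul, Nat.abs_cast]
      nlinarith
    rw [h1, abs_div]
    have h3 : |(q : ℝ) * (A * θ) - a| / |(q : ℝ) * A| ≤ K ^ C / (N : ℝ) ^ (d + 1) :=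
      (div_le_self (abs_nonneg _) h2).trans ha
    calc (N : ℝ) ^ (d + 1) * (|(q : ℝ) * (A * θ) - a| / |(q : ℝ) * A|)
        ≤ (N : ℝ) ^ (d + 1) * (K ^ C / (N : ℝ) ^ (d + 1)) := by gcongr
      _ = K ^ C := by field_simp
      _ ≤ K ^ (C + 1) := pow_le_pow_right₀ (by linarith) (by omega)

theorem sin_two_pi_rat_mul_congr (r : ℚ) {m m' : ℤ} (h : (r.den : ℤ) ∣ m - m') :
    Real.sin (2 * Real.pi * (r * m)) = Real.sin (2 * Real.pi * (r * m')) := by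
  obtain ⟨t, ht⟩ := h
  have h1 : (m : ℝ) = m' + r.den * t := by
    have : m = m' + r.den * t := by omega
    exact_mod_cast this
  have h2 : (r : ℝ) * r.den = r.num := by exact_mod_cast Rat.mul_den_eq_num r
  rw [← Real.sin_add_int_mul_two_pi (2 * Real.pi * (r * m')) (r.num * t), h1]
  congr 1
  push_cast
  rw [← h2]
  ring

/-- Pairing `j` with `q - j` shows that a full period sums to zero, so only an incomplete period, of
fewer than `q` terms, can survive. -/
theorem abs_sum_range_le_of_periodic_antisymm {b : ℕ → ℝ} {q : ℕ} (hq : 1 ≤ q)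
    (hb : ∀ j, |b j| ≤ 1) (hper : ∀ j, b (j + q) = b j) (hanti : ∀ j ≤ q, b (q - j) = -b j)
    (k : ℕ) : |∑ j ∈ Finset.range k, b j| ≤ q := by
  have hzero : ∑ j ∈ Finset.range q, b j = 0 := by
    have h1 : ∑ j ∈ Finset.range q, b (j + 1) = ∑ j ∈ Finset.range q, b j := by
      have h2 := Finset.sum_range_succ b q
      have h3 := Finset.sum_range_succ' b q
      have h4 := hper 0
      rw [zero_add] at h4
      linarith
    have h2 : ∑ j ∈ Finset.range q, b (j + 1) = -∑ j ∈ Finset.range q, b j := by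
      rw [← Finset.sum_range_reflect, ← Finset.sum_neg_distrib]
      refine Finset.sum_congr rfl fun j hj => ?_
      have hj' := Finset.mem_range.1 hj
      rw [← hanti j hj'.le]
      congr 1
      omega
    linarith
  induction k using Nat.strong_induction_on with
  | _ k ih =>
    by_cases hk : k < q
    · refine (Finset.abs_sum_le_sum_abs _ _).trans ?_
      refine (Finset.sum_le_card_nsmul _ _ 1 fun j _ => hb j).trans ?_
      simp only [Finset.card_range, nsmul_eq_mul, mul_one]
      exact_mod_cast hk.le
    · obtain ⟨l, rfl⟩ : ∃ l, k = q + l := ⟨k - q, by omega⟩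
      rw [Finset.sum_range_add, hzero, zero_add]
      rw [Finset.sum_congr rfl fun j _ => by rw [add_comm q j, hper j]]
      exact ih l (by omega)

theorem eval_neg_of_odd_coeff {R : Type*} [CommRing R] {F : Polynomial R}
    (hodd : ∀ i, F.coeff i ≠ 0 → Odd i) (x : R) : F.eval (-x) = -F.eval x := by
  rw [Polynomial.eval_eq_sum_range, Polynomial.eval_eq_sum_range, ← Finset.sum_neg_distrib]
  refine Finset.sum_congr rfl fun i _ => ?_
  by_cases h : F.coeff i = 0
  · simp [h]
  · rw [(hodd i h).neg_pow, mul_neg]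

/-- This is where odd powers are essential: integrality of `F` gives the period `r.den`, and oddness
gives the antisymmetry within it. -/
theorem abs_sineSum_rat_le {F : Polynomial ℤ} (hodd : ∀ i, F.coeff i ≠ 0 → Odd i) (r : ℚ) (k : ℕ) :
    |sineSum F r k| ≤ r.den := by
  refine abs_sum_range_le_of_periodic_antisymm r.den_pos (fun j => Real.abs_sin_le_one _) ?_ ?_ k
  · intro j
    apply sin_two_pi_rat_mul_congr
    refine dvd_trans ?_ (Polynomial.sub_dvd_eval_sub _ _ F)
    simp
  · intro j hj
    rw [← Real.sin_neg, ← mul_neg, ← mul_neg, ← Int.cast_neg, ← eval_neg_of_odd_coeff hodd]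
    apply sin_two_pi_rat_mul_congr
    refine dvd_trans ?_ (Polynomial.sub_dvd_eval_sub _ _ F)
    push_cast [hj]
    simp

theorem abs_eval_le_pow (F : Polynomial ℤ) {d : ℕ} (hF : F.natDegree = d) :
    ∃ B : ℝ, 0 ≤ B ∧ ∀ N j : ℕ, 1 ≤ N → j ≤ N →
      |((F.eval (j : ℤ) : ℤ) : ℝ)| ≤ B * (N : ℝ) ^ d := by
  refine ⟨∑ i ∈ Finset.range (d + 1), |(F.coeff i : ℝ)|, by positivity, fun N j hN hj => ?_⟩
  rw [Polynomial.eval_eq_sum_range, hF, Finset.sum_mul]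
  push_cast
  refine (Finset.abs_sum_le_sum_abs _ _).trans (Finset.sum_le_sum fun i hi => ?_)
  rw [abs_mul, abs_pow, Nat.abs_cast]
  have h1 : (j : ℝ) ≤ N := by exact_mod_cast hj
  have h2 : (1 : ℝ) ≤ N := by exact_mod_cast hN
  have h3 : i ≤ d := Nat.lt_succ_iff.1 (Finset.mem_range.1 hi)
  gcongr
  exact (pow_le_pow_left₀ (by positivity) h1 i).trans (pow_le_pow_right₀ h2 h3)

/-- Near a rational with denominator `q` the sums are controlled by the distance and `q`. -/
theorem abs_sineSum_le_near_rat {F : Polynomial ℤ} {d : ℕ} (hF : F.natDegree = d)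
    (hodd : ∀ i, F.coeff i ≠ 0 → Odd i) :
    ∃ B : ℝ, 0 ≤ B ∧ ∀ (N k : ℕ) (θ : ℝ) (r : ℚ), 1 ≤ N → k ≤ N →
      |sineSum F θ k| ≤ N * (B * ((N : ℝ) ^ d * |θ - r|)) + r.den := by
  obtain ⟨B, hB0, hB⟩ := abs_eval_le_pow F hF
  refine ⟨2 * Real.pi * B, by positivity, fun N k θ r hN hk => ?_⟩
  have h1 : |sineSum F θ k - sineSum F r k| ≤
      N * (2 * Real.pi * B * ((N : ℝ) ^ d * |θ - r|)) := by
    rw [sineSum, sineSum, ← Finset.sum_sub_distrib]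
    refine (Finset.abs_sum_le_sum_abs _ _).trans ?_
    refine (Finset.sum_le_card_nsmul _ _ (2 * Real.pi * B * ((N : ℝ) ^ d * |θ - r|))
      fun j hj => ?_).trans ?_
    · refine (Real.abs_sin_sub_sin_le _ _).trans ?_
      rw [← mul_sub, ← sub_mul, abs_mul, abs_of_pos Real.two_pi_pos, abs_mul]
      have := hB N j hN ((Finset.mem_range.1 hj).le.trans hk)
      calc 2 * Real.pi * (|θ - r| * |((F.eval (j : ℤ) : ℤ) : ℝ)|)
          ≤ 2 * Real.pi * (|θ - r| * (B * (N : ℝ) ^ d)) := by gcongr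
        _ = _ := by ring
    · rw [Finset.card_range, nsmul_eq_mul]
      have : (k : ℝ) ≤ N := by exact_mod_cast hk
      gcongr
  have h2 := abs_sineSum_rat_le hodd r k
  have h3 := abs_sub_abs_le_abs_sub (sineSum F θ k) (sineSum F r k)
  linarith

/-! ### Summation over dyadic scales. -/

theorem sum_pow_le_geometric {x : ℝ} (h0 : 0 ≤ x) (h1 : x < 1) (T : Finset ℕ) :
    ∑ s ∈ T, x ^ s ≤ (1 - x)⁻¹ := by
  rw [← tsum_geometric_of_lt_one h0 h1]
  exact (summable_geometric_of_lt_one h0 h1).sum_le_tsum T fun i _ => pow_nonneg h0 i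

/-- If every term of a finite sum is at most `1` and is dominated by a nonnegative quantity attached
to any earlier index, then the sum is at most one more than the sum of these quantities. -/
theorem sum_le_one_add_sum_of_dominated {g r : ℕ → ℝ} (T : Finset ℕ) (hr : ∀ s, 0 ≤ r s)
    (hg : ∀ t ∈ T, g t ≤ 1) (hgr : ∀ s ∈ T, ∀ t ∈ T, s < t → g t ≤ r s) :
    ∑ t ∈ T, g t ≤ 1 + ∑ s ∈ T, r s := by
  -- The largest index dominates nothing, so its `r` is dropped. The induction then spends the `r`
  -- of the previous maximum on the newly added index.
  suffices h : ∀ t₀ ∈ T, (∀ s ∈ T, s ≤ t₀) → ∑ t ∈ T, g t ≤ 1 + ∑ s ∈ T.erase t₀, r s by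
    rcases T.eq_empty_or_nonempty with rfl | hT
    · simp
    · refine (h _ (T.max'_mem hT) fun s hs => T.le_max' s hs).trans ?_
      have := Finset.sum_le_sum_of_subset_of_nonneg (f := r) (Finset.erase_subset (T.max' hT) T)
        fun i _ _ => hr i
      linarith
  induction T using Finset.induction_on_max with
  | empty => simp
  | insert t T ht ih =>
    intro t₀ ht₀ hmax
    have htT : t ∉ T := fun h => lt_irrefl _ (ht t h)
    have h1 : t₀ = t := by
      rcases Finset.mem_insert.1 ht₀ with h | h
      · exact h
      · exact absurd (ht t₀ h) (not_lt.2 (hmax t (Finset.mem_insert_self _ _)))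
    rw [h1, Finset.erase_insert htT, Finset.sum_insert htT]
    rcases T.eq_empty_or_nonempty with rfl | hT
    · simpa using hg t (Finset.mem_insert_self _ _)
    · have h2 := ih (fun s hs => hg s (Finset.mem_insert_of_mem hs))
        (fun s hs u hu => hgr s (Finset.mem_insert_of_mem hs) u (Finset.mem_insert_of_mem hu))
        (T.max' hT) (T.max'_mem hT) fun s hs => T.le_max' s hs
      have h3 := hgr _ (Finset.mem_insert_of_mem (T.max'_mem hT)) t (Finset.mem_insert_self _ _)
        (ht _ (T.max'_mem hT))
      rw [← Finset.sum_erase_add T r (T.max'_mem hT)]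
      linarith

/-- Summation over scales which are grouped by a label: within one label the sum telescopes, and
labels that appear later carry geometrically small weights. -/
theorem sum_le_of_grouped {κ : Type*} [DecidableEq κ] {σ : ℕ → ℝ} {I : ℕ} (S : Finset ℕ)
    (hS : ∀ i ∈ S, i < I) (r : ℕ → κ) (w : κ → ℝ) (Φ : κ → ℕ → ℝ) {M ν μ : ℝ} (hM : 0 ≤ M)
    (hν : 0 ≤ ν) (hμ : 0 ≤ μ) (hμ1 : μ < 1) (hw : ∀ p, 0 ≤ w p) (hw1 : ∀ p, w p ≤ 1)
    (hΦ : ∀ p, Monotone (Φ p)) (hΦ0 : ∀ p, 0 ≤ Φ p 0) (hΦ1 : ∀ p, Φ p I ≤ 1)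
    (hσ0 : ∀ i, 0 ≤ σ i)
    (hσ : ∀ i ∈ S, σ i ≤ w (r i) * (M * (Φ (r i) (i + 1) - Φ (r i) i)))
    (hsep : ∀ s ∈ S, ∀ t ∈ S, s < t → r s ≠ r t → w (r t) ≤ ν * μ ^ s) :
    ∑ i ∈ S, σ i ≤ (1 + ν * (1 - μ)⁻¹) * M := by
  -- `T` keeps the first scale of each label, so each label is counted once and distinct elements of
  -- `T` have distinct labels.
  set T := S.filter (fun t => ∀ s ∈ S, r s = r t → t ≤ s) with hT
  have hfirst : ∀ i ∈ S, ∃ t ∈ T, r t = r i := by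
    intro i hi
    have hne : (S.filter (fun s => r s = r i)).Nonempty := ⟨i, Finset.mem_filter.2 ⟨hi, rfl⟩⟩
    have hmem := Finset.mem_filter.1 (Finset.min'_mem _ hne)
    refine ⟨_, Finset.mem_filter.2 ⟨hmem.1, fun s hs hst => ?_⟩, hmem.2⟩
    exact Finset.min'_le _ _ (Finset.mem_filter.2 ⟨hs, hst.trans hmem.2⟩)
  have h1 : ∑ i ∈ S, σ i ≤ ∑ i ∈ S, ∑ t ∈ T, if r t = r i then σ i else 0 := by
    refine Finset.sum_le_sum fun i hi => ?_
    obtain ⟨t, ht, hti⟩ := hfirst i hi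
    have := Finset.single_le_sum (f := fun t => if r t = r i then σ i else 0)
      (fun u _ => by split_ifs <;> simp [hσ0]) ht
    simpa [hti] using this
  have h2 : ∀ t ∈ T, (∑ i ∈ S, if r t = r i then σ i else 0) ≤ w (r t) * M := by
    intro t _
    have h3 : ∀ i ∈ S, (if r t = r i then σ i else 0) ≤
        w (r t) * (M * (Φ (r t) (i + 1) - Φ (r t) i)) := by
      intro i hi
      split_ifs with h
      · rw [h]
        exact hσ i hi
      · have := hΦ (r t) (Nat.le_succ i)
        exact mul_nonneg (hw _) (mul_nonneg hM (sub_nonneg.2 this))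
    refine (Finset.sum_le_sum h3).trans ?_
    rw [← Finset.mul_sum, ← Finset.mul_sum]
    refine mul_le_mul_of_nonneg_left (mul_le_of_le_one_right hM ?_) (hw _)
    refine (Finset.sum_le_sum_of_subset_of_nonneg (t := Finset.range I)
      (fun i hi => Finset.mem_range.2 (hS i hi))
      fun i _ _ => sub_nonneg.2 (hΦ (r t) (Nat.le_succ i))).trans ?_
    rw [Finset.sum_range_sub]
    have := hΦ0 (r t)
    have := hΦ1 (r t)
    linarith
  have h4 : ∑ t ∈ T, w (r t) ≤ 1 + ν * (1 - μ)⁻¹ := by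
    refine (sum_le_one_add_sum_of_dominated (g := fun t => w (r t)) (r := fun s => ν * μ ^ s) T
      (fun s => by positivity) (fun t _ => hw1 _) ?_).trans ?_
    · intro s hs t ht hst
      refine hsep s (Finset.mem_filter.1 hs).1 t (Finset.mem_filter.1 ht).1 hst fun h => ?_
      exact absurd ((Finset.mem_filter.1 ht).2 s (Finset.mem_filter.1 hs).1 h) (not_le.2 hst)
    · rw [← Finset.mul_sum]
      have := mul_le_mul_of_nonneg_left (sum_pow_le_geometric hμ hμ1 T) hν
      linarith
  calc ∑ i ∈ S, σ i ≤ ∑ i ∈ S, ∑ t ∈ T, if r t = r i then σ i else 0 := h1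
    _ = ∑ t ∈ T, ∑ i ∈ S, if r t = r i then σ i else 0 := Finset.sum_comm
    _ ≤ ∑ t ∈ T, w (r t) * M := Finset.sum_le_sum h2
    _ = (∑ t ∈ T, w (r t)) * M := by rw [Finset.sum_mul]
    _ ≤ _ := mul_le_mul_of_nonneg_right h4 hM

theorem one_le_den_mul_den_mul_abs_sub {r s : ℚ} (h : r ≠ s) :
    (1 : ℝ) ≤ r.den * s.den * |(r : ℝ) - s| := by
  have h1 : (r : ℝ) * r.den = r.num := by exact_mod_cast Rat.mul_den_eq_num r
  have h2 : (s : ℝ) * s.den = s.num := by exact_mod_cast Rat.mul_den_eq_num s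
  have h3 : r.num * s.den - s.num * r.den ≠ 0 := by
    rw [sub_ne_zero]
    exact fun h4 => h (Rat.eq_iff_mul_eq_mul.2 h4)
  have h4 : (1 : ℝ) ≤ |((r.num * s.den - s.num * r.den : ℤ) : ℝ)| := by
    exact_mod_cast Int.one_le_abs h3
  have h5 : ((r.num * s.den - s.num * r.den : ℤ) : ℝ) = (r.den * s.den) * ((r : ℝ) - s) := by
    push_cast
    rw [← h1, ← h2]
    ring
  rw [h5, abs_mul, abs_of_nonneg (by positivity)] at h4
  exact h4

/-- If `σ u` decays both as `z → 0` and as `z → ∞`, it is dominated by the increment of the bounded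
function `z ↦ z / (1 + z)` under a dilation. -/
theorem le_increment_of_two_sided_decay {x z r K : ℝ} (hz : 0 ≤ z) (hr : 1 < r)
    (h1 : x ≤ K) (h2 : x ≤ K * z) (h3 : x * z ≤ K) :
    x ≤ 2 * (1 + r) * K / (r - 1) * (r * z / (1 + r * z) - z / (1 + z)) := by
  have hr' : 0 < r - 1 := by linarith
  have hrz : 0 ≤ r * z := by positivity
  have h4 : r * z / (1 + r * z) - z / (1 + z) = (r - 1) * z / ((1 + r * z) * (1 + z)) := by
    rw [div_sub_div _ _ (by positivity) (by positivity)]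
    congr 1
    ring
  have h5 : 2 * (1 + r) * K / (r - 1) * ((r - 1) * z / ((1 + r * z) * (1 + z))) =
      2 * (1 + r) * K * z / ((1 + r * z) * (1 + z)) := by
    field_simp
  rw [h4, h5, le_div_iff₀ (by positivity)]
  have h6 : x * z ≤ K * z := mul_le_mul_of_nonneg_right h1 hz
  have h7 : x * z * z ≤ K * z := mul_le_mul_of_nonneg_right h3 hz
  have h8 : r * (x * z * z) ≤ r * (K * z) := mul_le_mul_of_nonneg_left h7 (by linarith)
  have h9 : (1 + r) * (x * z) ≤ (1 + r) * (K * z) := mul_le_mul_of_nonneg_left h6 (by linarith)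
  linarith

/-- Put `η = 1/(4C)`, `u = q^η`, `z = Y^η`. The exponent is small enough that `σu²` and `σz²` are
both at most `K₀`; multiplying these gives the decay for large `Y`. For `Y ≤ 1` one has `Y ≤ z²`,
and `(σu)² = (σu²)σ` combined with `σ ≤ 2BY` gives the decay for small `Y`. -/
theorem two_sided_decay {C : ℕ} {σ q Y K₀ B : ℝ} (hC : 1 ≤ C) (hσpos : 0 < σ) (hσ1 : σ ≤ 1)
    (hK₀ : 1 ≤ K₀) (hp0 : 1 ≤ q) (hY0 : 0 ≤ Y) (hp1 : q ≤ (K₀ / σ) ^ C)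
    (hp2 : Y ≤ (K₀ / σ) ^ C) (hσY : σ ≤ 2 * B * Y) :
    σ * q ^ (1 / (4 * C) : ℝ) ≤ max K₀ (2 * B) ∧
      σ * q ^ (1 / (4 * C) : ℝ) ≤ max K₀ (2 * B) * Y ^ (1 / (4 * C) : ℝ) ∧
      σ * q ^ (1 / (4 * C) : ℝ) * Y ^ (1 / (4 * C) : ℝ) ≤ max K₀ (2 * B) := by
  have hC0 : (0 : ℝ) < C := by exact_mod_cast hC
  have hC1 : (1 : ℝ) ≤ C := by exact_mod_cast hC
  set η : ℝ := 1 / (4 * C) with hη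
  have hη0 : 0 < η := by positivity
  have hη4 : η ≤ 1 / 4 := by
    rw [hη]
    exact one_div_le_one_div_of_le (by norm_num) (by linarith)
  set K₁ : ℝ := max K₀ (2 * B) with hK₁
  have hK₁0 : 1 ≤ K₁ := hK₀.trans (le_max_left _ _)
  have hKσ : 1 ≤ K₀ / σ := by
    rw [le_div_iff₀ hσpos]
    linarith
  have hsq : ∀ y : ℝ, 0 ≤ y → y ≤ (K₀ / σ) ^ C → σ * (y ^ η) ^ 2 ≤ K₀ := by
    intro y hy hyK
    have h1 : (y ^ η) ^ 2 ≤ K₀ / σ := by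
      calc (y ^ η) ^ 2 ≤ (((K₀ / σ) ^ C) ^ η) ^ 2 := by gcongr
        _ = (K₀ / σ) ^ (1 / 2 : ℝ) := by
            rw [← Real.rpow_natCast (K₀ / σ), ← Real.rpow_mul (by positivity),
              ← Real.rpow_natCast _ 2, ← Real.rpow_mul (by positivity), hη]
            congr 1
            field_simp
            norm_num
        _ ≤ (K₀ / σ) ^ (1 : ℝ) := Real.rpow_le_rpow_of_exponent_le hKσ (by norm_num)
        _ = K₀ / σ := Real.rpow_one _
    calc σ * (y ^ η) ^ 2 ≤ σ * (K₀ / σ) := mul_le_mul_of_nonneg_left h1 hσpos.le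
      _ = K₀ := by field_simp
  set u : ℝ := q ^ η with hu
  have hu1 : 1 ≤ u := Real.one_le_rpow hp0 hη0.le
  have hu2 : σ * u ^ 2 ≤ K₀ := hsq _ (by positivity) hp1
  have hz2 : σ * (Y ^ η) ^ 2 ≤ K₀ := hsq _ hY0 hp2
  set zz : ℝ := Y ^ η with hzz
  have hzz0 : 0 ≤ zz := by positivity
  have hKK : K₀ ≤ K₁ := le_max_left _ _
  have h1 : σ * u ≤ K₁ := by nlinarith
  have h3 : σ * u * zz ≤ K₁ := by
    refine abs_le_of_sq_le_sq' ?_ (by linarith) |>.2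
    calc (σ * u * zz) ^ 2 = (σ * u ^ 2) * (σ * zz ^ 2) := by ring
      _ ≤ K₁ * K₁ := mul_le_mul (hu2.trans hKK) (hz2.trans hKK) (by positivity) (by linarith)
      _ = K₁ ^ 2 := by ring
  have h2 : σ * u ≤ K₁ * zz := by
    rcases le_total 1 zz with h | h
    · nlinarith
    · have hY1 : Y ≤ 1 := by
        by_contra hcon
        exact absurd (Real.one_lt_rpow (not_le.1 hcon) hη0) (not_lt.2 h)
      have hYz : Y ≤ zz ^ 2 := by
        rw [hzz, ← Real.rpow_natCast, ← Real.rpow_mul hY0]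
        rcases hY0.eq_or_lt with h0 | h0
        · rw [← h0]
          positivity
        · have := Real.rpow_le_rpow_of_exponent_ge h0 hY1
            (show η * ((2 : ℕ) : ℝ) ≤ 1 by push_cast; linarith)
          rwa [Real.rpow_one] at this
      refine abs_le_of_sq_le_sq' ?_ (by positivity) |>.2
      calc (σ * u) ^ 2 = (σ * u ^ 2) * σ := by ring
        _ ≤ K₁ * (2 * B * Y) := mul_le_mul (hu2.trans hKK) hσY (by positivity) (by linarith)
        _ ≤ K₁ * (K₁ * zz ^ 2) := by
            refine mul_le_mul_of_nonneg_left ?_ (by linarith)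
            exact mul_le_mul (le_max_right _ _) hYz hY0 (by linarith)
        _ = (K₁ * zz) ^ 2 := by ring
  exact ⟨h1, h2, h3⟩

/-- Scales with exponentially small `σ i` sum geometrically. Each other scale is labelled by its
rational: the two-sided decay telescopes within a label, and the repulsion of rationals makes the
weights `q^{-η}` of successive labels geometrically small. -/
theorem exists_bound_sum_scales (C d : ℕ) (hC : 1 ≤ C) {K₀ : ℝ} (B : ℝ) (hK₀ : 1 ≤ K₀) :
    ∃ M : ℝ, 0 ≤ M ∧ ∀ (θ : ℝ) (σ : ℕ → ℝ), (∀ i, 0 ≤ σ i) → (∀ i, σ i ≤ 1) →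
      (∀ i, 0 < σ i → ∃ r : ℚ, (r.den : ℝ) ≤ (K₀ / σ i) ^ C ∧
        ((2 : ℝ) ^ i) ^ (d + 1) * |θ - r| ≤ (K₀ / σ i) ^ C) →
      (∀ i (r : ℚ), σ i ≤ B * (((2 : ℝ) ^ i) ^ (d + 1) * |θ - r|) + r.den / 2 ^ i) →
      ∀ I, ∑ i ∈ Finset.range I, σ i ≤ M := by
  have hC0 : (0 : ℝ) < C := by exact_mod_cast hC
  have hC1 : (1 : ℝ) ≤ C := by exact_mod_cast hC
  -- At scale `2^i = l^{4i}` denominators may be as large as `L l^i`, while the distances to `θ` are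
  -- at most `L l^{-3i}`. This leaves room for the separation argument.
  set l : ℝ := (2 : ℝ) ^ (1 / 4 : ℝ) with hl
  have hl4 : l ^ 4 = 2 := by
    rw [hl, ← Real.rpow_natCast, ← Real.rpow_mul (by norm_num)]
    norm_num
  have hl1 : 1 < l := Real.one_lt_rpow (by norm_num) (by norm_num)
  have hl0 : 0 < l := by linarith
  have hli : ∀ i : ℕ, (2 : ℝ) ^ i = (l ^ i) ^ 4 := fun i => by
    rw [← hl4, ← pow_mul, ← pow_mul, mul_comm]
  have hlinv : l⁻¹ < 1 := inv_lt_one_of_one_lt₀ hl1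
  set η : ℝ := 1 / (4 * C) with hη
  have hη0 : 0 < η := by positivity
  have hη4 : η ≤ 1 / 4 := by
    rw [hη]
    exact one_div_le_one_div_of_le (by norm_num) (by linarith)
  -- Chosen so that `σ i ≥ ρ^i` implies `(K₀ / σ i) ^ C ≤ L l^i`.
  set ρ : ℝ := (l⁻¹) ^ (1 / C : ℝ) with hρ
  have hρ0 : 0 < ρ := Real.rpow_pos_of_pos (by positivity) _
  have hρ1 : ρ < 1 := Real.rpow_lt_one (by positivity) hlinv (by positivity)
  have hlρ : l⁻¹ ≤ ρ := by
    have h1 : (1 / C : ℝ) ≤ 1 := by rw [div_le_one hC0]; exact hC1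
    have h2 := Real.rpow_le_rpow_of_exponent_ge (inv_pos.2 hl0) hlinv.le h1
    rwa [Real.rpow_one] at h2
  set μ : ℝ := (l⁻¹) ^ η with hμ
  have hμ0 : 0 < μ := Real.rpow_pos_of_pos (by positivity) _
  have hμ1 : μ < 1 := Real.rpow_lt_one (by positivity) hlinv hη0
  set L : ℝ := K₀ ^ C with hL
  have hL1 : 1 ≤ L := one_le_pow₀ hK₀
  set ν : ℝ := (2 * L ^ 2) ^ η with hν
  have hν0 : 0 ≤ ν := by positivity
  set R : ℝ := ((2 : ℝ) ^ (d + 1)) ^ η with hR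
  have hR1 : 1 < R := Real.one_lt_rpow (one_lt_pow₀ (by norm_num) (by omega)) hη0
  set K₁ : ℝ := max K₀ (2 * B) with hK₁
  have hK₁0 : 1 ≤ K₁ := hK₀.trans (le_max_left _ _)
  set M₂ : ℝ := 2 * (1 + R) * K₁ / (R - 1) with hM₂
  have hM₂0 : 0 ≤ M₂ := div_nonneg (by positivity) (by linarith)
  refine ⟨2 * L * (1 - ρ)⁻¹ + (1 + ν * (1 - μ)⁻¹) * M₂, ?_, ?_⟩
  · have h1 : 0 ≤ (1 - ρ)⁻¹ := inv_nonneg.2 (by linarith)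
    have h2 : 0 ≤ (1 - μ)⁻¹ := inv_nonneg.2 (by linarith)
    positivity
  intro θ σ hσ0 hσ1 happrox hnear I
  set z : ℚ → ℕ → ℝ := fun p i => (((2 : ℝ) ^ i) ^ (d + 1) * |θ - p|) ^ η with hz
  have hz0 : ∀ p i, 0 ≤ z p i := fun p i => by positivity
  have hzs : ∀ p i, z p (i + 1) = R * z p i := by
    intro p i
    rw [hz, hR]
    dsimp only
    rw [← Real.mul_rpow (by positivity) (by positivity)]
    congr 1
    ring
  set Φ : ℚ → ℕ → ℝ := fun p i => z p i / (1 + z p i) with hΦ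
  -- The factor `2L` ensures that on `S` the term `den / 2^i ≤ L ρ^i` is less than half of `σ i`, so
  -- it can be absorbed.
  set S := (Finset.range I).filter (fun i => 2 * L * ρ ^ i < σ i) with hS
  have hkey : ∀ i ∈ S, ∃ p : ℚ, (p.den : ℝ) ≤ L * l ^ i ∧ |θ - p| ≤ L * (l⁻¹) ^ (3 * i) ∧
      σ i ≤ ((p.den : ℝ) ^ η)⁻¹ * (M₂ * (Φ p (i + 1) - Φ p i)) := by
    intro i hi
    have hbig := (Finset.mem_filter.1 hi).2
    have hli0 : 0 < l ^ i := by positivity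
    have hli1 : 1 ≤ l ^ i := one_le_pow₀ hl1.le
    have hσpos : 0 < σ i := lt_trans (by positivity) hbig
    have hKσ : 1 ≤ K₀ / σ i := by
      rw [le_div_iff₀ hσpos]
      linarith [hσ1 i]
    have hbad : 1 ≤ σ i ^ C * l ^ i := by
      have h1 : ρ ^ i ≤ σ i := by
        refine le_trans ?_ hbig.le
        have : 0 < ρ ^ i := by positivity
        nlinarith
      have h2 : (ρ ^ i) ^ C = (l ^ i)⁻¹ := by
        rw [← pow_mul, mul_comm, pow_mul, hρ, ← Real.rpow_natCast _ C,
          ← Real.rpow_mul (by positivity), one_div_mul_cancel hC0.ne', Real.rpow_one, inv_pow]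
      have h3 : (l ^ i)⁻¹ ≤ σ i ^ C := h2 ▸ pow_le_pow_left₀ (by positivity) h1 C
      calc (1 : ℝ) = (l ^ i)⁻¹ * l ^ i := by field_simp
        _ ≤ _ := mul_le_mul_of_nonneg_right h3 hli0.le
    have hKC : (K₀ / σ i) ^ C ≤ L * l ^ i := by
      rw [div_pow, div_le_iff₀ (by positivity), ← hL]
      nlinarith
    obtain ⟨p, hp1, hp2⟩ := happrox i hσpos
    have hp0 : (1 : ℝ) ≤ p.den := by exact_mod_cast p.den_pos
    have hN1 : (1 : ℝ) ≤ 2 ^ i := one_le_pow₀ (by norm_num)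
    have hq := hp1.trans hKC
    refine ⟨p, hq, ?_, ?_⟩
    · have h1 : (2 : ℝ) ^ i * |θ - p| ≤ L * l ^ i := by
        refine le_trans (mul_le_mul_of_nonneg_right ?_ (abs_nonneg _)) (hp2.trans hKC)
        exact le_self_pow₀ hN1 (by omega)
      have h2 : L * (l⁻¹) ^ (3 * i) = L * l ^ i / 2 ^ i := by
        rw [hli, inv_pow, mul_comm 3 i, pow_mul]
        field_simp
      rw [h2, le_div_iff₀ (by positivity)]
      linarith
    · set Y : ℝ := ((2 : ℝ) ^ i) ^ (d + 1) * |θ - p| with hY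
      have hY0 : 0 ≤ Y := by positivity
      have hσY : σ i ≤ 2 * B * Y := by
        have h1 := hnear i p
        have h2 : (p.den : ℝ) / 2 ^ i ≤ L * ρ ^ i := by
          rw [div_le_iff₀ (by positivity), hli]
          have h3 : 1 ≤ ρ ^ i * l ^ i := by
            rw [← mul_pow]
            refine one_le_pow₀ ?_
            calc (1 : ℝ) = l⁻¹ * l := by field_simp
              _ ≤ ρ * l := mul_le_mul_of_nonneg_right hlρ hl0.le
          calc (p.den : ℝ) ≤ L * l ^ i := hq
            _ ≤ L * l ^ i * ((ρ ^ i * l ^ i) * (l ^ i * l ^ i)) := by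
                refine le_mul_of_one_le_right (by positivity) ?_
                exact one_le_mul_of_one_le_of_one_le h3 (one_le_mul_of_one_le_of_one_le hli1 hli1)
            _ = L * ρ ^ i * (l ^ i) ^ 4 := by ring
        linarith
      obtain ⟨h1, h2, h3⟩ := two_sided_decay hC hσpos (hσ1 i) hK₀ hp0 hY0 hp1 hp2 hσY
      rw [← hη, ← hK₁] at h1 h2 h3
      have hzY : z p i = Y ^ η := rfl
      have h4 := le_increment_of_two_sided_decay (by positivity) hR1 h1 h2 h3
      rw [← hzY, ← hzs p i] at h4
      rw [← div_eq_inv_mul, le_div_iff₀ (by positivity)]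
      exact h4
  choose! r hr1 hr2 hr3 using hkey
  have hsmall : ∑ i ∈ (Finset.range I).filter (fun i => ¬ 2 * L * ρ ^ i < σ i), σ i ≤
      2 * L * (1 - ρ)⁻¹ := by
    calc _ ≤ ∑ i ∈ (Finset.range I).filter (fun i => ¬ 2 * L * ρ ^ i < σ i), 2 * L * ρ ^ i :=
          Finset.sum_le_sum fun i hi => not_lt.1 (Finset.mem_filter.1 hi).2
      _ ≤ _ := by
          rw [← Finset.mul_sum]
          exact mul_le_mul_of_nonneg_left (sum_pow_le_geometric hρ0.le hρ1 _) (by linarith)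
  have hlarge : ∑ i ∈ S, σ i ≤ (1 + ν * (1 - μ)⁻¹) * M₂ := by
    refine sum_le_of_grouped (I := I) S (fun i hi => Finset.mem_range.1 (Finset.mem_filter.1 hi).1) r
      (fun p => ((p.den : ℝ) ^ η)⁻¹) Φ hM₂0 hν0 hμ0.le hμ1 (fun p => by positivity) ?_ ?_ ?_ ?_ hσ0
      hr3 ?_
    · intro p
      refine inv_le_one_of_one_le₀ (Real.one_le_rpow ?_ hη0.le)
      exact_mod_cast p.den_pos
    · intro p
      refine monotone_nat_of_le_succ fun i => ?_
      have h1 := hz0 p i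
      have h2 := hz0 p (i + 1)
      have h3 : z p i ≤ z p (i + 1) := by rw [hzs]; nlinarith
      rw [hΦ]
      dsimp only
      rw [div_le_div_iff₀ (by linarith) (by linarith)]
      linarith
    · intro p
      have := hz0 p 0
      positivity
    · intro p
      have := hz0 p I
      rw [hΦ]
      dsimp only
      rw [div_le_one (by linarith)]
      linarith
    -- Both rationals lie within `L l^{-3s}` of `θ`, yet they differ by at least the reciprocal of
    -- the product of their denominators. As the earlier denominator is at most `L l^s`, the later
    -- one is at least `l^s / (2L²)`.
    · intro s hs t ht hst hne
      have h1 := one_le_den_mul_den_mul_abs_sub hne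
      have h2 : |((r s : ℚ) : ℝ) - r t| ≤ 2 * L * (l⁻¹) ^ (3 * s) := by
        have h3 := hr2 s hs
        have h4 := hr2 t ht
        have h5 : (l⁻¹) ^ (3 * t) ≤ (l⁻¹) ^ (3 * s) :=
          pow_le_pow_of_le_one (by positivity) hlinv.le (by omega)
        have h6 := mul_le_mul_of_nonneg_left h5 (by linarith : 0 ≤ L)
        have h7 := abs_sub_le ((r s : ℚ) : ℝ) θ (r t)
        rw [abs_sub_comm _ θ] at h7
        linarith
      have ht0 : (1 : ℝ) ≤ (r t).den := by exact_mod_cast (r t).den_pos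
      have h3 : 1 ≤ (r t).den * (2 * L ^ 2 * (l⁻¹) ^ s) := by
        calc (1 : ℝ) ≤ (r s).den * (r t).den * |((r s : ℚ) : ℝ) - r t| := h1
          _ ≤ (L * l ^ s) * (r t).den * (2 * L * (l⁻¹) ^ (3 * s)) := by
              gcongr
              exact hr1 s hs
          _ = (r t).den * (2 * L ^ 2 * ((l * l⁻¹) ^ s * ((l⁻¹) ^ s * (l⁻¹) ^ s))) := by ring
          _ ≤ (r t).den * (2 * L ^ 2 * (l⁻¹) ^ s) := by
              rw [mul_inv_cancel₀ hl0.ne', one_pow, one_mul]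
              gcongr
              exact mul_le_of_le_one_right (by positivity) (pow_le_one₀ (by positivity) hlinv.le)
      have h4 : (1 : ℝ) ≤ ((r t).den : ℝ) ^ η * (ν * μ ^ s) := by
        have h5 := Real.one_le_rpow h3 hη0.le
        rw [Real.mul_rpow (by positivity) (by positivity),
          Real.mul_rpow (by positivity) (by positivity)] at h5
        have h6 : ((l⁻¹) ^ s) ^ η = μ ^ s := by
          rw [hμ, ← Real.rpow_natCast, ← Real.rpow_mul (by positivity), mul_comm,
            Real.rpow_mul (by positivity), Real.rpow_natCast]
        rwa [h6] at h5
      rw [inv_le_iff_one_le_mul₀ (by positivity), mul_comm]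
      exact h4
  rw [← Finset.sum_filter_add_sum_filter_not (Finset.range I) (fun i => 2 * L * ρ ^ i < σ i)]
  linarith

/-- Uniform dyadic summability of the sums `∑_{j < k} sin (2 π θ F(j))`. -/
theorem exists_bound_sum_sineSum {F : Polynomial ℤ} {d : ℕ} (hF : F.natDegree = d + 1)
    (hodd : ∀ i, F.coeff i ≠ 0 → Odd i) :
    ∃ M : ℝ, 0 ≤ M ∧ ∀ (θ : ℝ) (κ : ℕ → ℕ), (∀ i, κ i ≤ 2 ^ i) →
      ∀ I, ∑ i ∈ Finset.range I, |sineSum F θ (κ i)| / 2 ^ i ≤ M := by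
  obtain ⟨C, K₀, hC, hK₀, happ⟩ := rat_near_of_sineSum_large F hF
  obtain ⟨B, -, hnear⟩ := abs_sineSum_le_near_rat hF hodd
  obtain ⟨M, hM0, hM⟩ := exists_bound_sum_scales C d hC B (by linarith : 1 ≤ K₀)
  refine ⟨M, hM0, fun θ κ hκ I => hM θ (fun i => |sineSum F θ (κ i)| / 2 ^ i) ?_ ?_ ?_ ?_ I⟩
  · intro i
    positivity
  · intro i
    rw [div_le_one (by positivity)]
    refine (abs_sineSum_le_length F θ _).trans ?_
    exact_mod_cast hκ i
  · intro i hi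
    have hle : |sineSum F θ (κ i)| / 2 ^ i ≤ 1 := by
      rw [div_le_one (by positivity)]
      refine (abs_sineSum_le_length F θ _).trans ?_
      exact_mod_cast hκ i
    obtain ⟨p, hp1, hp2⟩ := happ (K₀ / (|sineSum F θ (κ i)| / 2 ^ i)) (2 ^ i) (κ i) θ
      (by rw [le_div_iff₀ hi]; nlinarith) Nat.one_le_two_pow (hκ i) (by
        have h0 : 0 < |sineSum F θ (κ i)| := by
          by_contra h
          have h' : |sineSum F θ (κ i)| = 0 := le_antisymm (not_lt.1 h) (abs_nonneg _)
          simp only [h', zero_div, lt_irrefl] at hi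
        have h1 : K₀ / (|sineSum F θ (κ i)| / 2 ^ i) * |sineSum F θ (κ i)| = K₀ * 2 ^ i := by
          field_simp
        rw [h1]
        push_cast
        have : (0 : ℝ) < 2 ^ i := by positivity
        nlinarith)
    push_cast at hp2
    exact ⟨p, hp1, hp2⟩
  · intro i p
    have h1 := hnear (2 ^ i) (κ i) θ p Nat.one_le_two_pow (hκ i)
    push_cast at h1
    rw [div_le_iff₀ (by positivity), add_mul, div_mul_cancel₀ _ (by positivity)]
    linarith

/-! ### Rest bounded variation and Abel summation. -/

theorem IsRBVS.exists_bounds {c : ℕ → ℝ} (hV : IsRBVS c) (hc : ∀ k : ℕ, 1 ≤ k → 0 ≤ c k) :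
    ∃ V : ℝ, 0 ≤ V ∧
      (∀ l m : ℕ, 1 ≤ l → ∑ k ∈ Finset.Ico l m, |c k - c (k + 1)| ≤ V * c l) ∧
      ∀ l m : ℕ, 1 ≤ l → l ≤ m → c m ≤ (V + 1) * c l := by
  obtain ⟨V, hV⟩ := hV
  have h1 : ∀ l m : ℕ, 1 ≤ l → ∑ k ∈ Finset.Ico l m, |c k - c (k + 1)| ≤ max V 0 * c l := by
    intro l m hl
    rw [Finset.sum_Ico_eq_sum_range]
    refine ((hV l hl).1.sum_le_tsum _ fun j _ => abs_nonneg _).trans ((hV l hl).2.trans ?_)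
    exact mul_le_mul_of_nonneg_right (le_max_left _ _) (hc l hl)
  refine ⟨max V 0, le_max_right _ _, h1, fun l m hl hlm => ?_⟩
  have h2 : c m - c l ≤ ∑ k ∈ Finset.Ico l m, |c k - c (k + 1)| := by
    rw [← Finset.sum_Ico_sub c hlm]
    refine Finset.sum_le_sum fun k _ => ?_
    rw [abs_sub_comm]
    exact le_abs_self _
  have := h1 l m hl
  linarith

theorem sum_Ico_mul_eq_by_parts (c a : ℕ → ℝ) {m n : ℕ} (hmn : m ≤ n) :
    ∑ k ∈ Finset.Ico m n, c k * a k =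
      c n * ∑ j ∈ Finset.range n, a j - c m * ∑ j ∈ Finset.range m, a j +
        ∑ k ∈ Finset.Ico m n, (c k - c (k + 1)) * ∑ j ∈ Finset.range (k + 1), a j := by
  induction n, hmn using Nat.le_induction with
  | base => simp
  | succ n hmn ih =>
    rw [Finset.sum_Ico_succ_top hmn, Finset.sum_Ico_succ_top hmn, ih, Finset.sum_range_succ]
    ring

/-- Summation by parts over dyadic blocks. -/
theorem abs_sum_Ico_mul_le {c a : ℕ → ℝ} {V M ε : ℝ} {m n : ℕ} (hm : 1 ≤ m) (hmn : m ≤ n)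
    (hc : ∀ k : ℕ, 1 ≤ k → 0 ≤ c k) (hV0 : 0 ≤ V)
    (hV : ∀ l m : ℕ, 1 ≤ l → ∑ k ∈ Finset.Ico l m, |c k - c (k + 1)| ≤ V * c l)
    (ha : ∀ k, |∑ j ∈ Finset.range k, a j| ≤ k)
    (hM : ∀ κ : ℕ → ℕ, (∀ i, κ i ≤ 2 ^ i) →
      ∀ I, ∑ i ∈ Finset.range I, |∑ j ∈ Finset.range (κ i), a j| / 2 ^ i ≤ M)
    (hε : ∀ k, m ≤ k → c k * k ≤ ε) :
    |∑ k ∈ Finset.Ico m n, c k * a k| ≤ (2 + 2 * V * M) * ε := by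
  set T : ℕ → ℝ := fun k => ∑ j ∈ Finset.range k, a j with hT
  have hε0 : 0 ≤ ε := (mul_nonneg (hc m hm) (Nat.cast_nonneg m)).trans (hε m le_rfl)
  have hbdry : ∀ k, m ≤ k → |c k * T k| ≤ ε := by
    intro k hk
    rw [abs_mul, abs_of_nonneg (hc k (hm.trans hk))]
    exact (mul_le_mul_of_nonneg_left (ha k) (hc k (hm.trans hk))).trans (hε k hk)
  -- The dyadic bound holds for every choice of lengths `κ i`, so the maximizing length may be taken
  -- at each scale.
  have hmax : ∀ i : ℕ, ∃ k, k ≤ 2 ^ i ∧ ∀ j ≤ 2 ^ i, |T j| ≤ |T k| := by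
    intro i
    obtain ⟨k, hk, hk'⟩ := Finset.exists_max_image (Finset.range (2 ^ i + 1)) (fun j => |T j|)
      ⟨0, by simp⟩
    exact ⟨k, Nat.lt_succ_iff.1 (Finset.mem_range.1 hk),
      fun j hj => hk' j (Finset.mem_range.2 (Nat.lt_succ_of_le hj))⟩
  choose κ hκ1 hκ2 using hmax
  have hblock : ∀ i, ∑ k ∈ (Finset.Ico m n).filter (fun k => Nat.log 2 k = i),
      |c k - c (k + 1)| * |T (k + 1)| ≤ 2 * V * ε * (|T (κ (i + 1))| / 2 ^ (i + 1)) := by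
    intro i
    -- The block containing `m` is cut at `m`, since the bound on `c k * k` is available only from
    -- there on.
    set l := max m (2 ^ i) with hl
    have hl1 : 1 ≤ l := hm.trans (le_max_left _ _)
    have hcl : c l ≤ ε / 2 ^ i := by
      rw [le_div_iff₀ (by positivity)]
      refine le_trans (mul_le_mul_of_nonneg_left ?_ (hc l hl1)) (hε l (le_max_left _ _))
      exact_mod_cast le_max_right m (2 ^ i)
    have hmem : ∀ k ∈ (Finset.Ico m n).filter (fun k => Nat.log 2 k = i),
        k ∈ Finset.Ico l n ∧ k + 1 ≤ 2 ^ (i + 1) := by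
      intro k hk
      obtain ⟨hk1, hk2⟩ := Finset.mem_filter.1 hk
      obtain ⟨hk3, hk4⟩ := Finset.mem_Ico.1 hk1
      have h1 := Nat.pow_log_le_self 2 (by omega : k ≠ 0)
      have h2 := Nat.lt_pow_succ_log_self (b := 2) (by norm_num) k
      rw [hk2] at h1 h2
      exact ⟨Finset.mem_Ico.2 ⟨max_le hk3 h1, hk4⟩, h2⟩
    calc _ ≤ ∑ k ∈ (Finset.Ico m n).filter (fun k => Nat.log 2 k = i),
          |c k - c (k + 1)| * |T (κ (i + 1))| :=
          Finset.sum_le_sum fun k hk => mul_le_mul_of_nonneg_left (hκ2 _ _ (hmem k hk).2)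
            (abs_nonneg _)
      _ = (∑ k ∈ (Finset.Ico m n).filter (fun k => Nat.log 2 k = i), |c k - c (k + 1)|) *
          |T (κ (i + 1))| := by rw [Finset.sum_mul]
      _ ≤ (V * (ε / 2 ^ i)) * |T (κ (i + 1))| := by
          refine mul_le_mul_of_nonneg_right ?_ (abs_nonneg _)
          refine (Finset.sum_le_sum_of_subset_of_nonneg (fun k hk => (hmem k hk).1)
            fun _ _ _ => abs_nonneg _).trans ((hV l n hl1).trans ?_)
          exact mul_le_mul_of_nonneg_left hcl hV0
      _ = _ := by
          field_simp
          ring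
  have hsum : ∑ k ∈ Finset.Ico m n, |c k - c (k + 1)| * |T (k + 1)| ≤ 2 * V * M * ε := by
    rw [← Finset.sum_fiberwise_of_maps_to (t := Finset.range n) (g := Nat.log 2)
      (fun k hk => Finset.mem_range.2
        ((Nat.log_le_self 2 k).trans_lt (Finset.mem_Ico.1 hk).2))]
    refine (Finset.sum_le_sum fun i _ => hblock i).trans ?_
    rw [← Finset.mul_sum]
    have h1 := hM κ hκ1 (n + 1)
    rw [Finset.sum_range_succ'] at h1
    have h2 : 0 ≤ |∑ j ∈ Finset.range (κ 0), a j| / 2 ^ 0 := by positivity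
    calc _ ≤ 2 * V * ε * M := by
          refine mul_le_mul_of_nonneg_left ?_ (by positivity)
          linarith
      _ = _ := by ring
  rw [sum_Ico_mul_eq_by_parts c a hmn]
  have h1 := hbdry n hmn
  have h2 := hbdry m le_rfl
  have h3 : |∑ k ∈ Finset.Ico m n, (c k - c (k + 1)) * T (k + 1)| ≤ 2 * V * M * ε := by
    refine (Finset.abs_sum_le_sum_abs _ _).trans (le_trans (le_of_eq ?_) hsum)
    exact Finset.sum_congr rfl fun k _ => abs_mul _ _
  have h4 := abs_add_le (c n * T n - c m * T m)
    (∑ k ∈ Finset.Ico m n, (c k - c (k + 1)) * T (k + 1))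
  have h5 := abs_sub (c n * T n) (c m * T m)
  calc _ ≤ _ := h4
    _ ≤ _ := by linarith

/-! ### Uniform convergence of sine series. -/

theorem sinePartialSum_sub (c φ : ℕ → ℝ) (x : ℝ) {m n : ℕ} (hmn : m ≤ n) :
    sinePartialSum c φ n x - sinePartialSum c φ m x =
      ∑ k ∈ Finset.Ico (m + 1) (n + 1), c k * Real.sin (φ k * x) := by
  have h : ∀ N, Finset.Icc 1 N = Finset.Ico 1 (N + 1) := fun N => by
    ext
    simp
  rw [sinePartialSum, sinePartialSum, h, h,
    ← Finset.sum_Ico_consecutive _ (by omega : 1 ≤ m + 1) (by omega : m + 1 ≤ n + 1)]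
  ring

/-- Cauchy criterion for uniform convergence of a sine series. -/
theorem sineSeriesConvergesUniformlyOn_iff (c φ : ℕ → ℝ) (X : Set ℝ) :
    SineSeriesConvergesUniformlyOn c φ X ↔
      ∀ ε > 0, ∃ N : ℕ, ∀ m n : ℕ, N ≤ m → m ≤ n → ∀ x ∈ X,
        |∑ k ∈ Finset.Ico m n, c k * Real.sin (φ k * x)| < ε := by
  constructor
  · rintro ⟨g, hg⟩ ε hε
    obtain ⟨N, hN⟩ := Metric.uniformCauchySeqOn_iff.1 hg.uniformCauchySeqOn ε hε
    refine ⟨N + 1, fun m n hm hmn x hx => ?_⟩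
    obtain ⟨m, rfl⟩ : ∃ m', m = m' + 1 := ⟨m - 1, by omega⟩
    obtain ⟨n, rfl⟩ : ∃ n', n = n' + 1 := ⟨n - 1, by omega⟩
    rw [← sinePartialSum_sub c φ x (by omega : m ≤ n), ← Real.dist_eq]
    exact hN n (by omega) m (by omega) x hx
  · intro h
    have hcauchy : UniformCauchySeqOn (sinePartialSum c φ) atTop X := by
      rw [Metric.uniformCauchySeqOn_iff]
      intro ε hε
      obtain ⟨N, hN⟩ := h ε hε
      refine ⟨N, fun m hm n hn x hx => ?_⟩
      rcases le_total m n with hmn | hmn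
      · rw [dist_comm, Real.dist_eq, sinePartialSum_sub c φ x hmn]
        exact hN _ _ (by omega) (by omega) x hx
      · rw [Real.dist_eq, sinePartialSum_sub c φ x hmn]
        exact hN _ _ (by omega) (by omega) x hx
    have hlim : ∀ x ∈ X, ∃ s, Tendsto (fun N => sinePartialSum c φ N x) atTop (𝓝 s) :=
      fun x hx => cauchySeq_tendsto_of_complete (hcauchy.cauchySeq hx)
    choose! g hg using hlim
    exact ⟨g, hcauchy.tendstoUniformlyOn_of_tendsto hg⟩

theorem SineSeriesConvergesUniformlyOn.mono {c φ : ℕ → ℝ} {X Y : Set ℝ}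
    (h : SineSeriesConvergesUniformlyOn c φ Y) (hXY : X ⊆ Y) :
    SineSeriesConvergesUniformlyOn c φ X :=
  h.imp fun _ hg => hg.mono hXY

theorem SineSeriesConvergesUniformlyOn.convergesAt {c φ : ℕ → ℝ} {X : Set ℝ}
    (h : SineSeriesConvergesUniformlyOn c φ X) {x : ℝ} (hx : x ∈ X) :
    SineSeriesConvergesAt c φ x :=
  let ⟨g, hg⟩ := h
  ⟨g x, hg.tendsto_at hx⟩

theorem sineSeriesConvergesUniformlyOn_of_summable {c : ℕ → ℝ} (hc : ∀ k : ℕ, 1 ≤ k → 0 ≤ c k)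
    (hs : Summable (fun k : ℕ => c (k + 1))) (φ : ℕ → ℝ) (X : Set ℝ) :
    SineSeriesConvergesUniformlyOn c φ X := by
  rw [sineSeriesConvergesUniformlyOn_iff]
  intro ε hε
  have hs' : Summable c := (summable_nat_add_iff 1).1 hs
  obtain ⟨N, hN⟩ := Metric.cauchySeq_iff.1 hs'.hasSum.tendsto_sum_nat.cauchySeq ε hε
  refine ⟨N + 1, fun m n hm hmn x _ => ?_⟩
  have h1 := hN n (by omega) m (by omega)
  rw [Real.dist_eq, ← Finset.sum_Ico_eq_sub _ hmn] at h1
  refine lt_of_le_of_lt ?_ ((le_abs_self _).trans_lt h1)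
  refine (Finset.abs_sum_le_sum_abs _ _).trans (Finset.sum_le_sum fun k hk => ?_)
  have hk0 := hc k (by have := (Finset.mem_Ico.1 hk).1; omega)
  rw [abs_mul, abs_of_nonneg hk0]
  exact mul_le_of_le_one_right hk0 (Real.abs_sin_le_one _)

/-! ### Even exponents: convergence at a point forces summability. -/

/-- All terms are nonnegative, so partial sums stay below the limit. In each block of `P` indices
every coefficient is at most `V + 1` times the first, and the first carries a sine of at least `s₀`.
-/
theorem summable_of_converges_of_periodic_lower_bound {c : ℕ → ℝ}
    (hc : ∀ k : ℕ, 1 ≤ k → 0 ≤ c k) (hV : IsRBVS c) {φ : ℕ → ℝ} {x s₀ : ℝ} {P : ℕ} (hP : 1 ≤ P)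
    (hs₀ : 0 < s₀) (hpos : ∀ k, 0 ≤ Real.sin (φ k * x))
    (hlow : ∀ j, s₀ ≤ Real.sin (φ (P * j + 1) * x)) (h : SineSeriesConvergesAt c φ x) :
    Summable (fun k : ℕ => c (k + 1)) := by
  obtain ⟨V, hV0, -, hV2⟩ := hV.exists_bounds hc
  obtain ⟨s, hs⟩ := h
  have hterm : ∀ k, 0 ≤ c (k + 1) * Real.sin (φ (k + 1) * x) := fun k =>
    mul_nonneg (hc _ (by omega)) (hpos _)
  have hsum : ∀ N, sinePartialSum c φ N x =
      ∑ k ∈ Finset.range N, c (k + 1) * Real.sin (φ (k + 1) * x) := by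
    intro N
    rw [sinePartialSum, Finset.range_eq_Ico,
      Finset.sum_Ico_add' (fun k => c k * Real.sin (φ k * x)) 0 N 1]
    rfl
  have hmono : Monotone (fun N => sinePartialSum c φ N x) := by
    refine monotone_nat_of_le_succ fun N => ?_
    rw [hsum, hsum, Finset.sum_range_succ]
    linarith [hterm N]
  have hle : ∀ N, sinePartialSum c φ N x ≤ s := fun N => hmono.ge_of_tendsto hs N
  have hblock : ∀ m, s₀ * ∑ k ∈ Finset.range (P * m), c (k + 1) ≤
      P * (V + 1) * sinePartialSum c φ (P * m) x := by
    intro m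
    induction m with
    | zero => simp [sinePartialSum]
    | succ m ih =>
      rw [hsum] at ih ⊢
      rw [Nat.mul_succ, Finset.sum_range_add, Finset.sum_range_add, mul_add, mul_add]
      refine add_le_add ih ?_
      have hcm := hc (P * m + 1) (by omega)
      have h1 : ∑ i ∈ Finset.range P, c (P * m + i + 1) ≤ P * ((V + 1) * c (P * m + 1)) := by
        refine (Finset.sum_le_card_nsmul _ _ ((V + 1) * c (P * m + 1))
          fun i _ => hV2 _ _ (by omega) (by omega)).trans ?_
        simp
      have h2 : c (P * m + 1) * s₀ ≤
          ∑ i ∈ Finset.range P, c (P * m + i + 1) * Real.sin (φ (P * m + i + 1) * x) := by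
        refine (mul_le_mul_of_nonneg_left (hlow m) hcm).trans ?_
        exact Finset.single_le_sum
          (f := fun i => c (P * m + i + 1) * Real.sin (φ (P * m + i + 1) * x))
          (fun i _ => hterm _) (Finset.mem_range.2 hP)
      calc _ ≤ s₀ * (P * ((V + 1) * c (P * m + 1))) := mul_le_mul_of_nonneg_left h1 hs₀.le
        _ = P * (V + 1) * (c (P * m + 1) * s₀) := by ring
        _ ≤ _ := mul_le_mul_of_nonneg_left h2 (by positivity)
  refine summable_of_sum_range_le (c := P * (V + 1) * s / s₀) (fun k => hc _ (by omega))
    fun N => ?_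
  rw [le_div_iff₀ hs₀, mul_comm]
  calc s₀ * ∑ k ∈ Finset.range N, c (k + 1) ≤ s₀ * ∑ k ∈ Finset.range (P * N), c (k + 1) := by
        refine mul_le_mul_of_nonneg_left (Finset.sum_le_sum_of_subset_of_nonneg ?_ ?_) hs₀.le
        · exact Finset.range_mono (Nat.le_mul_of_pos_left N hP)
        · exact fun k _ _ => hc _ (by omega)
    _ ≤ _ := hblock N
    _ ≤ _ := mul_le_mul_of_nonneg_left (hle _) (by positivity)

theorem even_pow_mod {P n : ℕ} (hP : P = 3 ∨ P = 4) (hn : Even n) (k : ℕ) :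
    k ^ n % P = 0 ∨ k ^ n % P = 1 := by
  obtain ⟨e, rfl⟩ := hn
  have h1 : k ^ 2 % P = 0 ∨ k ^ 2 % P = 1 := by
    rcases hP with rfl | rfl
    · have := Nat.mod_lt k (by norm_num : 0 < 3)
      rw [Nat.pow_mod]
      interval_cases k % 3 <;> simp
    · have := Nat.mod_lt k (by norm_num : 0 < 4)
      rw [Nat.pow_mod]
      interval_cases k % 4 <;> simp
  rw [← two_mul, pow_mul, Nat.pow_mod]
  rcases h1 with h | h
  · rw [h]
    rcases Nat.eq_zero_or_pos e with rfl | he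
    · rcases hP with rfl | rfl <;> simp
    · rw [zero_pow he.ne']
      simp
  · rw [h, one_pow]
    rcases hP with rfl | rfl <;> simp

/-- Even powers at the points `2 π / 3` and `2 π / 4`, up to multiples of `2 π`. -/
theorem summable_of_even_pow_converges {c : ℕ → ℝ} (hc : ∀ k : ℕ, 1 ≤ k → 0 ≤ c k)
    (hV : IsRBVS c) {n P : ℕ} (hP : P = 3 ∨ P = 4) (hn : Even n) (m : ℤ)
    (h : SineSeriesConvergesAt c (fun k => (k : ℝ) ^ n) (2 * Real.pi / P + 2 * Real.pi * m)) :
    Summable (fun k : ℕ => c (k + 1)) := by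
  have hP3 : 3 ≤ P := by omega
  have hP0 : (0 : ℝ) < P := by
    have : 0 < P := by omega
    exact_mod_cast this
  have hs₀ : 0 < Real.sin (2 * Real.pi / P) := by
    refine Real.sin_pos_of_pos_of_lt_pi (by positivity) ?_
    rw [div_lt_iff₀ hP0]
    have : (3 : ℝ) ≤ P := by exact_mod_cast hP3
    nlinarith [Real.pi_pos]
  have hval : ∀ (y t r : ℕ), y = P * t + r →
      Real.sin ((y : ℝ) * (2 * Real.pi / P + 2 * Real.pi * m)) =
        Real.sin (r * (2 * Real.pi / P)) := by
    rintro y t r rfl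
    rw [← Real.sin_add_int_mul_two_pi (r * (2 * Real.pi / P)) (t + (P * t + r) * m)]
    congr 1
    push_cast
    field_simp
    ring
  have hone : ∀ j : ℕ, (P * j + 1) ^ n % P = 1 := by
    intro j
    rw [Nat.pow_mod, Nat.mul_add_mod, Nat.mod_eq_of_lt (by omega : 1 < P), one_pow,
      Nat.mod_eq_of_lt (by omega : 1 < P)]
  refine summable_of_converges_of_periodic_lower_bound hc hV (P := P) (by omega) hs₀ ?_ ?_ h
  · intro k
    have h1 := hval (k ^ n) _ _ (Nat.div_add_mod (k ^ n) P).symm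
    push_cast at h1
    rw [h1]
    rcases even_pow_mod hP hn k with h2 | h2
    · rw [h2]
      simp
    · rw [h2]
      simpa using hs₀.le
  · intro j
    have h1 := hval ((P * j + 1) ^ n) _ _ (Nat.div_add_mod ((P * j + 1) ^ n) P).symm
    rw [hone] at h1
    push_cast at h1 ⊢
    rw [h1, one_mul]

/-! ### Odd exponents: sufficiency and necessity. -/

theorem exists_integer_multiple (f : Polynomial ℚ) :
    ∃ (b : ℤ) (F : Polynomial ℤ), b ≠ 0 ∧ F.natDegree = f.natDegree ∧
      (∀ i, F.coeff i ≠ 0 → f.coeff i ≠ 0) ∧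
      ∀ k : ℕ, ((F.eval (k : ℤ) : ℤ) : ℚ) = b * f.eval (k : ℚ) := by
  obtain ⟨b, hbmem, hb⟩ := IsLocalization.integerNormalization_spec (nonZeroDivisors ℤ) f
  set F := IsLocalization.integerNormalization (nonZeroDivisors ℤ) f
  have hb0 : b ≠ 0 := nonZeroDivisors.ne_zero hbmem
  have hbq : (b : ℚ) ≠ 0 := by exact_mod_cast hb0
  have hmap : F.map (Int.castRingHom ℚ) = Polynomial.C (b : ℚ) * f := by
    have h1 : F.map (algebraMap ℤ ℚ) = b • f := hb
    rw [← algebraMap_int_eq, h1, ← Int.cast_smul_eq_zsmul ℚ, Polynomial.smul_eq_C_mul]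
  refine ⟨b, F, hb0, ?_, ?_, ?_⟩
  · rw [← Polynomial.natDegree_map_eq_of_injective (Int.castRingHom ℚ).injective_int F, hmap,
      Polynomial.natDegree_C_mul hbq]
  · intro i hi hfi
    have h1 := congrArg (fun p => p.coeff i) hmap
    simp only [Polynomial.coeff_map, Polynomial.coeff_C_mul, hfi, mul_zero, eq_intCast] at h1
    exact hi (by exact_mod_cast h1)
  · intro k
    have h1 := Polynomial.eval_intCast_map (Int.castRingHom ℚ) F (k : ℤ)
    rw [hmap, Polynomial.eval_mul, Polynomial.eval_C] at h1
    simp only [eq_intCast, Int.cast_natCast] at h1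
    exact h1.symm

theorem convergesUniformlyOn_univ_of_odd_polynomial {c : ℕ → ℝ} (hc : ∀ k : ℕ, 1 ≤ k → 0 ≤ c k)
    (hV : IsRBVS c) {f : Polynomial ℚ} (hdeg : f.natDegree ≠ 0)
    (hodd : ∀ i : ℕ, f.coeff i ≠ 0 → Odd i)
    (hlim : Tendsto (fun k : ℕ => c k * (k : ℝ)) atTop (𝓝 0)) :
    SineSeriesConvergesUniformlyOn c (fun k => ((f.eval (k : ℚ) : ℚ) : ℝ)) Set.univ := by
  obtain ⟨V, hV0, hV1, -⟩ := hV.exists_bounds hc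
  obtain ⟨b, F, hb, hFdeg, hFcoeff, hFeval⟩ := exists_integer_multiple f
  obtain ⟨d, hd⟩ := Nat.exists_eq_succ_of_ne_zero hdeg
  obtain ⟨M, hM0, hM⟩ := exists_bound_sum_sineSum (hFdeg.trans hd) fun i hi => hodd i (hFcoeff i hi)
  rw [sineSeriesConvergesUniformlyOn_iff]
  intro ε hε
  set A : ℝ := 2 + 2 * V * M with hA
  have hA0 : 0 < A := by positivity
  obtain ⟨N, hN⟩ := Filter.eventually_atTop.1
    (hlim.eventually (gt_mem_nhds (by positivity : (0 : ℝ) < ε / (2 * A))))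
  refine ⟨N + 1, fun m n hm hmn x _ => ?_⟩
  -- Rescaling `x` absorbs both `2π` and the common denominator `b`; nothing is lost because the
  -- bound `M` is uniform in `θ`.
  set θ : ℝ := x / (2 * Real.pi * b) with hθ
  have hb' : (b : ℝ) ≠ 0 := by exact_mod_cast hb
  have hterm : ∀ k : ℕ, Real.sin (((f.eval (k : ℚ) : ℚ) : ℝ) * x) =
      Real.sin (2 * Real.pi * (θ * (F.eval (k : ℤ) : ℤ))) := by
    intro k
    have h1 : ((F.eval (k : ℤ) : ℤ) : ℝ) = b * ((f.eval (k : ℚ) : ℚ) : ℝ) := by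
      exact_mod_cast congrArg (fun y : ℚ => (y : ℝ)) (hFeval k)
    rw [h1, hθ]
    congr 1
    have := Real.pi_ne_zero
    field_simp
  simp only [hterm]
  have hmain := abs_sum_Ico_mul_le (c := c)
    (a := fun j => Real.sin (2 * Real.pi * (θ * (F.eval (j : ℤ) : ℤ)))) (by omega : 1 ≤ m) hmn hc
    hV0 hV1 (abs_sineSum_le_length F θ) (hM θ) (ε := ε / (2 * A))
    (fun k hk => (hN k (by omega)).le)
  refine hmain.trans_lt ?_
  have : A * (ε / (2 * A)) = ε / 2 := by field_simp
  rw [← hA, this]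
  linarith

/-- At `x_j`, with `M = N₁ + j`, the arguments `k^n |x_j|` for `M ≤ k ≤ 2M` stay between a fixed `t
> 0` and `π/2`. The block sum therefore exceeds a constant multiple of `M c_k` for `k` just past the
block, and the Cauchy criterion makes it small. -/
theorem tendsto_mul_index_of_converges_near_zero {c : ℕ → ℝ} (hc : ∀ k : ℕ, 1 ≤ k → 0 ≤ c k)
    (hV : IsRBVS c) {n : ℕ} {X : Set ℝ} {γ : ℝ} (hγ : 2 ≤ γ) {x : ℕ → ℝ}
    (hx : IsDiscreteNhdZero (n : ℝ) γ x) (hxX : ∀ j, x j ∈ X)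
    (h : SineSeriesConvergesUniformlyOn c (fun k => (k : ℝ) ^ n) X) :
    Tendsto (fun k : ℕ => c k * (k : ℝ)) atTop (𝓝 0) := by
  obtain ⟨V, hV0, -, hV2⟩ := hV.exists_bounds hc
  obtain ⟨N₁, hN₁, hx⟩ := hx
  rw [sineSeriesConvergesUniformlyOn_iff] at h
  have hγ0 : 0 < γ := by linarith
  have hπ := Real.pi_pos
  set t : ℝ := Real.pi / γ ^ (n + 1) with ht
  have ht0 : 0 < t := by positivity
  -- This is the role of `γ ≥ 2`: doubling `k` multiplies the argument by `2^n` without passing the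
  -- maximum of the sine.
  have ht2 : 2 ^ n * t ≤ Real.pi / 2 := by
    rw [ht, ← mul_div_assoc, div_le_div_iff₀ (by positivity) (by norm_num)]
    calc 2 ^ n * Real.pi * 2 = Real.pi * 2 ^ (n + 1) := by ring
      _ ≤ Real.pi * γ ^ (n + 1) := by gcongr
  have ht3 : t ≤ Real.pi / 2 := by
    have : (1 : ℝ) ≤ 2 ^ n := one_le_pow₀ (by norm_num)
    nlinarith
  set s₀ : ℝ := Real.sin t with hs₀def
  have hs₀ : 0 < s₀ := Real.sin_pos_of_pos_of_lt_pi ht0 (by linarith)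
  have hlow : ∀ j k : ℕ, N₁ + j ≤ k → k ≤ 2 * (N₁ + j) →
      s₀ ≤ Real.sin ((k : ℝ) ^ n * |x j|) := by
    intro j k hk1 hk2
    have hM0 : (0 : ℝ) < (N₁ : ℝ) + j := by
      have : (1 : ℝ) ≤ N₁ := by exact_mod_cast hN₁
      positivity
    have hk1' : (N₁ : ℝ) + j ≤ k := by exact_mod_cast hk1
    have hk2' : (k : ℝ) ≤ 2 * (N₁ + j) := by exact_mod_cast hk2
    have harg : (k : ℝ) ^ n * |x j| = (k / (N₁ + j)) ^ n * t := by
      have h1 : γ ^ ((n : ℝ) + 1) = γ ^ (n + 1) := by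
        rw [← Real.rpow_natCast γ (n + 1)]
        push_cast
        rfl
      rw [hx j, h1, Real.rpow_natCast, ht, div_pow]
      field_simp
    have h1 : 1 ≤ (k : ℝ) / (N₁ + j) := by rw [le_div_iff₀ hM0]; linarith
    have h2 : (k : ℝ) / (N₁ + j) ≤ 2 := by rw [div_le_iff₀ hM0]; linarith
    rw [harg]
    refine Real.sin_le_sin_of_le_of_le_pi_div_two (by linarith) ?_ ?_
    · refine le_trans ?_ ht2
      gcongr
    · exact le_mul_of_one_le_left ht0.le (one_le_pow₀ h1)
  have habs : ∀ j : ℕ, ∀ S : Finset ℕ, |∑ k ∈ S, c k * Real.sin ((k : ℝ) ^ n * x j)| =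
      |∑ k ∈ S, c k * Real.sin ((k : ℝ) ^ n * |x j|)| := by
    intro j S
    rcases abs_choice (x j) with h1 | h1
    · rw [h1]
    · rw [h1]
      simp only [mul_neg, Real.sin_neg, Finset.sum_neg_distrib, abs_neg]
  rw [Metric.tendsto_atTop]
  intro ε hε
  obtain ⟨N, hN⟩ := h (ε * s₀ / (4 * (V + 1) ^ 2)) (by positivity)
  refine ⟨2 * (N + N₁), fun k hk => ?_⟩
  -- With `M = k / 2` the block `[M, 2M)` lies below `k`, so `c k ≤ (V + 1) c i` on it; rounding in
  -- the division is harmless because only `k ≤ 4M` is needed.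
  obtain ⟨j, hj⟩ : ∃ j, k / 2 = N₁ + j := ⟨k / 2 - N₁, by omega⟩
  set M := N₁ + j with hM
  have h1 := hN M (2 * M) (by omega) (by omega) (x j) (hxX j)
  rw [habs] at h1
  have hck := hc k (by omega)
  have h2 : ∀ i ∈ Finset.Ico M (2 * M),
      c k / (V + 1) * s₀ ≤ c i * Real.sin ((i : ℝ) ^ n * |x j|) := by
    intro i hi
    obtain ⟨hi1, hi2⟩ := Finset.mem_Ico.1 hi
    refine mul_le_mul ?_ (hlow j i hi1 hi2.le) hs₀.le (hc i (by omega))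
    rw [div_le_iff₀ (by positivity), mul_comm]
    exact hV2 i k (by omega) (by omega)
  have h3 := Finset.card_nsmul_le_sum _ _ _ h2
  rw [Nat.card_Ico, nsmul_eq_mul, show 2 * M - M = M by omega] at h3
  have h4 := (h3.trans (le_abs_self _)).trans_lt h1
  have hkM : (k : ℝ) ≤ 4 * M := by
    have : k ≤ 4 * M := by omega
    exact_mod_cast this
  rw [Real.dist_eq, sub_zero, abs_of_nonneg (by positivity)]
  have h5 : (M : ℝ) * c k * 4 * (V + 1) < ε := by
    have h6 : (M : ℝ) * (c k / (V + 1) * s₀) = (M * c k * 4 * (V + 1)) * (s₀ / (4 * (V + 1) ^ 2)) := by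
      field_simp
    have h7 : ε * s₀ / (4 * (V + 1) ^ 2) = ε * (s₀ / (4 * (V + 1) ^ 2)) := by ring
    rw [h6, h7] at h4
    exact lt_of_mul_lt_mul_right h4 (by positivity)
  refine lt_of_le_of_lt ?_ h5
  have h8 : 0 ≤ (M : ℝ) * c k * 4 := by positivity
  nlinarith

/-! ### The four assertions. -/

theorem mainTheorem3 (c : ℕ → ℝ) (hc : ∀ k : ℕ, 1 ≤ k → 0 ≤ c k) (hV : IsRBVS c) :
    -- even exponents, convergence at a point
    (∀ n : ℕ, 0 < n → Even n →
      (SineSeriesConvergesAt c (fun k => (k : ℝ) ^ n) (Real.pi / 2) ∨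
        SineSeriesConvergesAt c (fun k => (k : ℝ) ^ n) (2 * Real.pi / 3)) →
      Summable (fun k : ℕ => c (k + 1))) ∧
    -- rational polynomials of odd degree in odd powers, uniform convergence on the line
    (∀ n : ℕ, Odd n → ∀ f : Polynomial ℚ, f.natDegree = n →
      (∀ i : ℕ, f.coeff i ≠ 0 → Odd i) →
      Tendsto (fun k : ℕ => c k * (k : ℝ)) atTop (𝓝 0) →
      SineSeriesConvergesUniformlyOn c (fun k => ((f.eval (k : ℚ) : ℚ) : ℝ)) Set.univ) ∧
    -- even exponents, criterion
    (∀ n : ℕ, 0 < n → Even n → ∀ X : Set ℝ,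
      (∃ m : ℤ, Real.pi / 2 + 2 * Real.pi * (m : ℝ) ∈ X ∨
        2 * Real.pi / 3 + 2 * Real.pi * (m : ℝ) ∈ X) →
      (SineSeriesConvergesUniformlyOn c (fun k => (k : ℝ) ^ n) X ↔
        Summable (fun k : ℕ => c (k + 1)))) ∧
    -- odd exponents, criterion
    (∀ n : ℕ, Odd n → ∀ X : Set ℝ,
      (∃ γ : ℝ, 2 ≤ γ ∧ ∃ x : ℕ → ℝ, IsDiscreteNhdZero (n : ℝ) γ x ∧ ∀ j : ℕ, x j ∈ X) →
      (SineSeriesConvergesUniformlyOn c (fun k => (k : ℝ) ^ n) X ↔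
        Tendsto (fun k : ℕ => c k * (k : ℝ)) atTop (𝓝 0))) := by
  have hpt : ∀ (n : ℕ), Even n → ∀ m : ℤ,
      (SineSeriesConvergesAt c (fun k => (k : ℝ) ^ n) (Real.pi / 2 + 2 * Real.pi * (m : ℝ)) ∨
        SineSeriesConvergesAt c (fun k => (k : ℝ) ^ n) (2 * Real.pi / 3 + 2 * Real.pi * (m : ℝ))) →
      Summable (fun k : ℕ => c (k + 1)) := by
    rintro n hn m (h | h)
    · refine summable_of_even_pow_converges hc hV (P := 4) (Or.inr rfl) hn m ?_
      have : 2 * Real.pi / ((4 : ℕ) : ℝ) = Real.pi / 2 := by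
        push_cast
        ring
      rwa [this]
    · exact summable_of_even_pow_converges hc hV (P := 3) (Or.inl rfl) hn m (by exact_mod_cast h)
  refine ⟨?_, ?_, ?_, ?_⟩
  · intro n _ hn h
    exact hpt n hn 0 (by simpa using h)
  · intro n hn f hf hodd hlim
    exact convergesUniformlyOn_univ_of_odd_polynomial hc hV (by rw [hf]; exact hn.pos.ne') hodd hlim
  · rintro n _ hn X ⟨m, hm⟩
    refine ⟨fun h => hpt n hn m ?_, fun h => sineSeriesConvergesUniformlyOn_of_summable hc h _ _⟩
    exact hm.imp h.convergesAt h.convergesAt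
  · rintro n hn X ⟨γ, hγ, x, hx, hxX⟩
    refine ⟨tendsto_mul_index_of_converges_near_zero hc hV hγ hx hxX, fun hlim => ?_⟩
    have h := convergesUniformlyOn_univ_of_odd_polynomial hc hV (f := Polynomial.X ^ n)
      (by rw [Polynomial.natDegree_X_pow]; exact hn.pos.ne')
      (fun i hi => by
        rw [Polynomial.coeff_X_pow] at hi
        have : i = n := by
          by_contra hne
          exact hi (if_neg hne)
        rwa [this]) hlim
    simp only [Polynomial.eval_pow, Polynomial.eval_X, Rat.cast_pow, Rat.cast_natCast] at h
    exact h.mono (Set.subset_univ X)
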